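/- Let $A_0\ge 1$, $N\in\mathbb N$ and $0<\delta\le\frac1{1000}A_0^{-10}$. Let $X\neq\varnothing$ carry a quasi-distance $d$, i.e. $d(x,y)=d(y,x)\ge0$, $d(x,y)=0\iff x=y$, $d(x,y)\le A_0(d(x,z)+d(z,y))$, and suppose that every ball $B(x,r)=\{y:d(x,y)<r\}$ contains at most $N$ points at mutual distance exceeding $r/2$. The topology of $X$ is the one in which a set is open iff it contains a ball about each of its points. *Reference points and order.* Let $\mathscr X^k=\{x^k_\alpha\}_\alpha$, $k\in\mathbb Z$, be such that $\mathscr X^0$ is a maximal $1$-separated set in $X$ and, for $k=1,2,\dots$, $\mathscr X^{k}\supseteq\mathscr X^{k-1}$ is a maximal $\delta^{k}$-separated set in $X$ and $\mathscr X^{-k}$ is a maximal $\delta^{-k}$-separated subset of $\mathscr X^{-(k-1)}$ (a set is $r$-separated if its distinct points are at distance $\ge r$). Let each pair $(k+1,\beta)$ have exactly one parent $(k,\alpha)$, written $(k+1,\beta)\le(k,\alpha)$, in such a way that $$d(x^{k+1}_\beta,x^k_\alpha)<\tfrac1{2A_0}\delta^k\ \Rightarrow\ (k+1,\beta)\le(k,\alpha)\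 \Rightarrow\ d(x^{k+1}_\beta,x^k_\alpha)<2A_0\delta^k .$$ Two distinct pairs $(k,\alpha),(k,\beta)$ are neighbours if they have children $(k+1,\gamma)\le(k,\alpha)$, $(k+1,\theta)\le(k,\beta)$ with $d(x^{k+1}_\gamma,x^{k+1}_\theta)<(2A_0)^{-1}\delta^k$. Let $L$ be the maximal number of neighbours and $M$ the maximal number of children of a pair. Let $\operatorname{label}_1(k,\alpha)\in\{0,\dots,L\}$ be different for any two neighbours, and $\operatorname{label}_2(k,\alpha)\in\{1,\dots,M\}$ different for any two children of the same parent. *Random cubes.* Let $\Omega=(\{0,\dots,L\}\times\{1,\dots,M\})^{\mathbb Z}$ carry the probability $\mathbb P_\omega$ that makes the coordinates $\omega_k=(\ell_k,m_k)$ independent and uniformly distributed. For $\omega\in\Omega$ put $z^k_\alpha(\omega)=x^{k+1}_\beta$ if $\operatorname{label}_1(k,\alpha)=\ell_k$ and $(k+1,\beta)\le(k,\alpha)$ is a child with $\operatorname{label}_2(k+1,\beta)=m_k$, and $z^k_\alpha(\omega)=x^k_\alpha$ if $\operatorname{label}_1(k,\alpha)\ne\ell_k$ or there is no such child. Let $\le_\omega$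 be the reflexive and transitive relation on pairs generated by the rule: $(k+1,\beta)\le_\omega(k,\alpha)$ iff $d(x^{k+1}_\beta,z^k_\alpha)<\frac14A_0^{-2}\delta^k$, or $(k+1,\beta)\le(k,\alpha)$ and no $\gamma$ has $d(x^{k+1}_\beta,z^k_\gamma)<\frac14A_0^{-2}\delta^k$. Let $$\bar Q^k_\alpha(\omega)=\overline{\{z^\ell_\beta(\omega):(\ell,\beta)\le_\omega(k,\alpha)\}},\qquad \tilde Q^k_\alpha(\omega)=\operatorname{interior}\bar Q^k_\alpha(\omega).$$ **Theorem.** Such reference points, orders and labels exist, and for every choice of them the following hold. For all $\omega\in\Omega$ and $k\in\mathbb Z$: $$X=\bigcup_\alpha\bar Q^k_\alpha(\omega),\qquad \bar Q^k_\alpha(\omega)=\bigcup_{\beta:(k+1,\beta)\le_\omega(k,\alpha)}\bar Q^{k+1}_\beta(\omega),\qquad \bar Q^k_\alpha(\omega)\cap\tilde Q^k_\beta(\omega)=\varnothing\quad(\alpha\ne\beta),$$ $$B(z^k_\alpha,\tfrac16A_0^{-5}\delta^k)\subseteq\tilde Q^k_\alpha(\omega)\subseteq\bar Q^k_\alpha(\omega)\subseteq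 B(z^k_\alpha,6A_0^4\delta^k).$$ Moreover, there are $\eta\in(0,1]$ and $C>0$, depending only on $A_0$, $N$ and $\delta$, such that for all $x\in X$, $k\in\mathbb Z$ and $\varepsilon>0$ $$\mathbb P_\omega\Big(x\in\bigcup_\alpha\partial_\varepsilon Q^k_\alpha(\omega)\Big)\le C\varepsilon^\eta,\qquad \partial_\varepsilon Q^k_\alpha(\omega):=\{y\in\bar Q^k_\alpha(\omega):d(y,X\setminus\tilde Q^k_\alpha(\omega))<\varepsilon\delta^k\}$$ (where $d(y,\varnothing)=\infty$, and $\mathbb P_\omega$ of a possibly non-measurable event is its outer measure), and for all $x\in X$ $$\mathbb P_\omega\Big(x\in\bigcup_{k,\alpha}\partial Q^k_\alpha(\omega)\Big)=0,\qquad \partial Q^k_\alpha(\omega):=\bar Q^k_\alpha(\omega)\setminus\tilde Q^k_\alpha(\omega).$$ -/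

import Mathlib

open MeasureTheory

namespace QuasiDyadic

/-- `d` is a quasi-distance on `X` with quasi-triangle constant `A₀`. -/
structure IsQuasiDist {X : Type*} (A₀ : ℝ) (d : X → X → ℝ) : Prop where
  nonneg : ∀ x y, 0 ≤ d x y
  symm : ∀ x y, d x y = d y x
  eq_zero_iff : ∀ x y, d x y = 0 ↔ x = y
  quasi_triangle : ∀ x y z, d x y ≤ A₀ * (d x z + d z y)

/-- The ball `B(x, r) = {y : d(x, y) < r}`. It need not be open. -/
def ball {X : Type*} (d : X → X → ℝ) (x : X) (r : ℝ) : Set X := {y | d x y < r}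

/-- Geometric doubling with constant `N`: a ball of radius `r` contains at most `N` points at
mutual quasi-distance exceeding `r / 2`. -/
def GeomDoubling {X : Type*} (d : X → X → ℝ) (N : ℕ) : Prop :=
  ∀ (x : X) (r : ℝ) (S : Finset X), (S : Set X) ⊆ ball d x r →
    (S : Set X).Pairwise (fun y z => r / 2 < d y z) → S.card ≤ N

/-- The topology of `(X, d)`: a set is open when it contains a ball about each of its points. -/
@[reducible] def quasiTopology {X : Type*} (d : X → X → ℝ) : TopologicalSpace X where
  IsOpen U := ∀ x ∈ U, ∃ r > 0, ball d x r ⊆ U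
  isOpen_univ := fun _ _ => ⟨1, one_pos, Set.subset_univ _⟩
  isOpen_inter := by
    rintro U V hU hV x ⟨hxU, hxV⟩
    obtain ⟨r, hr, h⟩ := hU x hxU
    obtain ⟨s, hs, h'⟩ := hV x hxV
    refine ⟨min r s, lt_min hr hs, fun y hy => ?_⟩
    have hy' : d x y < min r s := hy
    exact ⟨h (lt_of_lt_of_le hy' (min_le_left r s)), h' (lt_of_lt_of_le hy' (min_le_right r s))⟩
  isOpen_sUnion := by
    rintro S hS x ⟨U, hU, hx⟩
    obtain ⟨r, hr, h⟩ := hS U hU x hx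
    exact ⟨r, hr, h.trans (Set.subset_sUnion_of_mem hU)⟩

/-- The quasi-distance from a point to a set, with value `∞` for the empty set. -/
noncomputable def distToSet {X : Type*} (d : X → X → ℝ) (y : X) (S : Set X) : ENNReal :=
  ⨅ w ∈ S, ENNReal.ofReal (d y w)

/-- `S` is a maximal `r`-separated subset of `Y`. -/
def IsMaxSeparated {X : Type*} (d : X → X → ℝ) (r : ℝ) (Y S : Set X) : Prop :=
  Maximal (fun T : Set X => T ⊆ Y ∧ T.Pairwise (fun x y => r ≤ d x y)) S

/-- Reference dyadic points and the reference partial order. The points of generation `k` form the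
set `pts k`, and serve as their own indices: the pair `(k, α)` is a point `α : pts k`, and
`x^k_α` is that point. The order is given by its one-step relations:
`(k+1, β) ≤ (k, α)` means `parent k β = α`. -/
structure ReferenceSystem {X : Type*} (d : X → X → ℝ) (A₀ δ : ℝ) where
  pts : ℤ → Set X
  pts_zero : IsMaxSeparated d 1 Set.univ (pts 0)
  pts_pos : ∀ n : ℕ, pts n ⊆ pts (n + 1) ∧
    IsMaxSeparated d (δ ^ ((n : ℤ) + 1)) Set.univ (pts (n + 1))
  pts_neg : ∀ n : ℕ,
    IsMaxSeparated d (δ ^ (-((n : ℤ) + 1))) (pts (-(n : ℤ))) (pts (-((n : ℤ) + 1)))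
  parent : ∀ k : ℤ, pts (k + 1) → pts k
  parent_of_near : ∀ (k : ℤ) (β : pts (k + 1)) (α : pts k),
    d β α < 1 / (2 * A₀) * δ ^ k → parent k β = α
  dist_parent : ∀ (k : ℤ) (β : pts (k + 1)), d β (parent k β) < 2 * A₀ * δ ^ k

namespace ReferenceSystem

variable {X : Type*} {d : X → X → ℝ} {A₀ δ : ℝ} (R : ReferenceSystem d A₀ δ)

/-- The children of `(k, α)`. -/
def children (k : ℤ) (α : R.pts k) : Set (R.pts (k + 1)) := {β | R.parent k β = α}

/-- Two distinct pairs of generation `k` are neighbours if they have children at distance less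
than `(2 A₀)⁻¹ δ ^ k`. -/
def IsNeighbour (k : ℤ) (α β : R.pts k) : Prop :=
  α ≠ β ∧ ∃ γ ∈ R.children k α, ∃ η ∈ R.children k β, d γ η < (2 * A₀)⁻¹ * δ ^ k

end ReferenceSystem

/-- A reference system with its labels: `L` is the maximal number of neighbours and `M` the maximal
number of children. Primary labels (in `{0, …, L}`) of neighbours differ, and so do secondary
labels of distinct children of the same parent; `Fin M` stands for `{1, …, M}`. -/
structure DyadicSystem {X : Type*} (d : X → X → ℝ) (A₀ δ : ℝ) extends
    ReferenceSystem d A₀ δ where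
  L : ℕ
  M : ℕ
  isGreatest_L : IsGreatest
    {n : ℕ∞ | ∃ (k : ℤ) (α : pts k), n = {β | toReferenceSystem.IsNeighbour k α β}.encard} L
  isGreatest_M : IsGreatest
    {n : ℕ∞ | ∃ (k : ℤ) (α : pts k), n = (toReferenceSystem.children k α).encard} M
  label₁ : ∀ k : ℤ, pts k → Fin (L + 1)
  label₂ : ∀ k : ℤ, pts k → Fin M
  label₁_ne : ∀ (k : ℤ) (α β : pts k), toReferenceSystem.IsNeighbour k α β →
    label₁ k α ≠ label₁ k β
  label₂_ne : ∀ (k : ℤ) (β γ : pts (k + 1)), β ≠ γ → parent k β = parent k γ →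
    label₂ (k + 1) β ≠ label₂ (k + 1) γ

namespace DyadicSystem

variable {X : Type*} {d : X → X → ℝ} {A₀ δ : ℝ} (D : DyadicSystem d A₀ δ)

theorem M_ne_zero : D.M ≠ 0 := by
  obtain ⟨k, α, -⟩ := D.isGreatest_M.1
  have h0 : (D.pts 0).Nonempty := by
    by_contra h
    rw [Set.not_nonempty_iff_eq_empty] at h
    have hmax := D.pts_zero
    rw [h] at hmax
    exact hmax.2 (y := {(α : X)}) ⟨Set.subset_univ _, Set.pairwise_singleton _ _⟩
      (Set.empty_subset _) (Set.mem_singleton _)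
  obtain ⟨b, hb⟩ := h0
  have hb' : b ∈ D.pts (0 + 1) := (D.pts_pos 0).1 hb
  have hM := D.isGreatest_M.2 ⟨0, D.parent 0 ⟨b, hb'⟩, rfl⟩
  intro hz
  rw [hz] at hM
  have h1 : (D.toReferenceSystem.children 0 (D.parent 0 ⟨b, hb'⟩)).encard = 0 :=
    le_antisymm hM bot_le
  rw [Set.encard_eq_zero] at h1
  have h2 : (⟨b, hb'⟩ : D.pts (0 + 1)) ∈
      D.toReferenceSystem.children 0 (D.parent 0 ⟨b, hb'⟩) := rfl
  rw [h1] at h2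
  exact h2

instance : NeZero D.M := ⟨D.M_ne_zero⟩

/-- The parameter space `({0, …, L} × {1, …, M})^ℤ`. -/
abbrev Param : Type := ℤ → Fin (D.L + 1) × Fin D.M

/-- The natural probability: the coordinates are independent and uniformly distributed. -/
noncomputable def prob : Measure D.Param :=
  Measure.infinitePi fun _ : ℤ => (PMF.uniformOfFintype (Fin (D.L + 1) × Fin D.M)).toMeasure

open Classical in
/-- The new dyadic point `z^k_α(ω)`. The child chosen in the first case is unique. -/
noncomputable def newPt (ω : D.Param) (k : ℤ) (α : D.pts k) : X :=
  if h : D.label₁ k α = (ω k).1 ∧ ∃ β : D.pts (k + 1), D.parent k β = α ∧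
      D.label₂ (k + 1) β = (ω k).2 then
    (h.2.choose : X)
  else α

/-- The one-step relation `(k+1, β) ≤_ω (k, α)`. -/
def NewChild (ω : D.Param) (k : ℤ) (β : D.pts (k + 1)) (α : D.pts k) : Prop :=
  d β (D.newPt ω k α) < 1 / 4 * (A₀ ^ 2)⁻¹ * δ ^ k ∨
    (D.parent k β = α ∧ ¬ ∃ γ : D.pts k, d β (D.newPt ω k γ) < 1 / 4 * (A₀ ^ 2)⁻¹ * δ ^ k)

/-- The new partial order `p ≤_ω q`: the reflexive and transitive closure of the one-step
relations. -/
def NewLE (ω : D.Param) : (Σ k : ℤ, D.pts k) → (Σ k : ℤ, D.pts k) → Prop :=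
  Relation.ReflTransGen fun p q => ∃ (k : ℤ) (β : D.pts (k + 1)) (α : D.pts k),
    p = ⟨k + 1, β⟩ ∧ q = ⟨k, α⟩ ∧ D.NewChild ω k β α

/-- The preliminary cube. -/
def preCube (ω : D.Param) (k : ℤ) (α : D.pts k) : Set X :=
  {x | ∃ (l : ℤ) (β : D.pts l), D.NewLE ω ⟨l, β⟩ ⟨k, α⟩ ∧ x = D.newPt ω l β}

/-- The closed cube. -/
def closedCube (ω : D.Param) (k : ℤ) (α : D.pts k) : Set X :=
  @closure X (quasiTopology d) (D.preCube ω k α)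

/-- The open cube. -/
def openCube (ω : D.Param) (k : ℤ) (α : D.pts k) : Set X :=
  @interior X (quasiTopology d) (D.closedCube ω k α)

/-- The boundary layer `∂_ε Q^k_α(ω)`. -/
def boundaryLayer (ε : ℝ) (ω : D.Param) (k : ℤ) (α : D.pts k) : Set X :=
  {y | y ∈ D.closedCube ω k α ∧
    distToSet d y (D.openCube ω k α)ᶜ < ENNReal.ofReal (ε * δ ^ k)}

/-- The boundary `∂ Q^k_α(ω)`. -/
def boundary (ω : D.Param) (k : ℤ) (α : D.pts k) : Set X :=
  D.closedCube ω k α \ D.openCube ω k α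

end DyadicSystem

end QuasiDyadic

-- Geometry, for a fixed `ω`: two neighbours never move simultaneously, since their primary labels
-- differ, so the new points of one generation stay `δ ^ k / (2 A₀)`-separated (`newPt_separated`).
-- Hence at most one of them is near a given point of the next generation, and `≤_ω` is a forest
-- order (`NewLE.unique`). Each generation costs one factor `A₀`, which the factor `δ` gained
-- absorbs, so descendants stay within a multiple of `δ ^ k` of their ancestor. Doubling makes the
-- cubes locally finite, so closures commute with the unions that occur and closed cubes split into
-- children (`mem_closedCube_iff`). Since `δ` is small, every cube of the next generation that comes
-- near a new point descends from it; this gives the inner balls and the disjointness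
-- (`newChild_of_mem_closedCube`).
--
-- Probability: fix `x` and, for each `m`, a point `β m` of generation `m + 1` near `x`. One value
-- of `ω m` turns `β m` into a new point of generation `m`, which puts `x` deep inside a cube of
-- that generation and so away from the boundary of any cube of generation `k ≤ m` on the
-- corresponding scale. If `ε` is at most a constant times `δ ^ n`, lying in the layer forces `n +
-- 1` independent coordinates to avoid such values (`exists_boundaryLayer_subset`). The probability
-- decays geometrically in `n`, that is, as a power of `ε`; letting `ε` tend to zero handles the
-- boundaries.

namespace QuasiDyadic

-- Scales, and the topology in terms of balls.

/-- The standing assumptions on the quasi-distance and on the two parameters. -/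
structure IsAdmissible {X : Type*} (d : X → X → ℝ) (A₀ δ : ℝ) : Prop where
  dist : IsQuasiDist A₀ d
  one_le : 1 ≤ A₀
  pos : 0 < δ
  small : δ ≤ 1 / 1000 * (A₀ ^ 10)⁻¹

variable {X : Type*} {d : X → X → ℝ} {A₀ δ : ℝ}

theorem IsQuasiDist.self (hd : IsQuasiDist A₀ d) (x : X) : d x x = 0 :=
  (hd.eq_zero_iff x x).2 rfl

theorem IsQuasiDist.triangle_lt (hd : IsQuasiDist A₀ d) (hA : 1 ≤ A₀) {x y z : X} {a b : ℝ}
    (hxz : d x z < a) (hzy : d z y < b) : d x y < A₀ * (a + b) :=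
  (hd.quasi_triangle x y z).trans_lt
    (mul_lt_mul_of_pos_left (add_lt_add hxz hzy) (by linarith))

namespace IsAdmissible

theorem A_pos (h : IsAdmissible d A₀ δ) : 0 < A₀ := by linarith [h.one_le]

theorem zpow_pos (h : IsAdmissible d A₀ δ) (k : ℤ) : 0 < δ ^ k := _root_.zpow_pos h.pos k

theorem zpow_succ (h : IsAdmissible d A₀ δ) (k : ℤ) : δ ^ (k + 1) = δ ^ k * δ :=
  zpow_add_one₀ h.pos.ne' k

theorem pow_mul_le (h : IsAdmissible d A₀ δ) {j : ℕ} (hj : j ≤ 10) : A₀ ^ j * δ ≤ 1 / 1000 := by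
  have h1 : A₀ ^ j ≤ A₀ ^ 10 := pow_le_pow_right₀ h.one_le hj
  have h2 : 0 < A₀ ^ 10 := pow_pos h.A_pos 10
  calc A₀ ^ j * δ ≤ A₀ ^ 10 * (1 / 1000 * (A₀ ^ 10)⁻¹) :=
        mul_le_mul h1 h.small h.pos.le h2.le
    _ = 1 / 1000 := by rw [mul_left_comm, mul_inv_cancel₀ h2.ne', mul_one]

theorem le_thousandth (h : IsAdmissible d A₀ δ) : δ ≤ 1 / 1000 := by
  simpa using h.pow_mul_le (j := 0) (by norm_num)

theorem zpow_anti (h : IsAdmissible d A₀ δ) {k l : ℤ} (hkl : k ≤ l) : δ ^ l ≤ δ ^ k :=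
  zpow_le_zpow_right_of_le_one₀ h.pos (by linarith [h.le_thousandth]) hkl

/-- Some power of `δ` beats any given positive number. -/
theorem exists_zpow_lt (h : IsAdmissible d A₀ δ) (k : ℤ) {r : ℝ} (hr : 0 < r) :
    ∃ n : ℕ, δ ^ (k + n) < r := by
  obtain ⟨n, hn⟩ := exists_pow_lt_of_lt_one (div_pos hr (h.zpow_pos k))
    (by linarith [h.le_thousandth] : δ < 1)
  refine ⟨n, ?_⟩
  rw [zpow_add₀ h.pos.ne', zpow_natCast]
  rw [lt_div_iff₀ (h.zpow_pos k)] at hn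
  linarith

/-- Balls need not be open, but halving the radius up to the factor `A₀` leaves a whole ball of
centres whose own balls lie in `S`. -/
theorem mem_interior (h : IsAdmissible d A₀ δ) {S : Set X} {x : X} :
    x ∈ @interior X (quasiTopology d) S ↔ ∃ r > 0, ball d x r ⊆ S := by
  let := quasiTopology d
  constructor
  · intro hx
    obtain ⟨r, hr, hr'⟩ := (isOpen_interior : IsOpen (interior S)) x hx
    exact ⟨r, hr, hr'.trans interior_subset⟩
  · rintro ⟨r, hr, hrS⟩
    have hA := h.A_pos
    refine Set.mem_of_subset_of_mem (s₁ := {y | ∃ r > 0, ball d y r ⊆ S})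
      (interior_maximal ?_ ?_) ⟨r, hr, hrS⟩
    · rintro y ⟨s, hs, hsS⟩
      refine hsS ?_
      change d y y < s
      rwa [h.dist.self]
    · rintro y ⟨s, hs, hsS⟩
      refine ⟨s / (2 * A₀), by positivity, fun z hz => ⟨s / (2 * A₀), by positivity,
        fun w hw => hsS ?_⟩⟩
      have := h.dist.triangle_lt h.one_le hz hw
      refine this.trans_le (le_of_eq ?_)
      field_simp
      ring

theorem mem_closure (h : IsAdmissible d A₀ δ) {S : Set X} {x : X} :
    x ∈ @closure X (quasiTopology d) S ↔ ∀ r > 0, ∃ y ∈ S, d x y < r := by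
  let := quasiTopology d
  rw [closure_eq_compl_interior_compl, Set.mem_compl_iff, h.mem_interior]
  push Not
  refine forall₂_congr fun r _ => ?_
  rw [Set.not_subset]
  simp only [Set.mem_compl_iff, not_not, ball, Set.mem_ofPred_eq]
  exact ⟨fun ⟨y, h1, h2⟩ => ⟨y, h2, h1⟩, fun ⟨y, h1, h2⟩ => ⟨y, h2, h1⟩⟩

/-- The closure of a locally finite union is the union of the closures. -/
theorem exists_mem_closure_of_finite (h : IsAdmissible d A₀ δ) {ι : Type*} {S : ι → Set X} {x : X}
    {r : ℝ} (hr : 0 < r) (hfin : {i | ∃ y ∈ S i, d x y < r}.Finite)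
    (hx : x ∈ @closure X (quasiTopology d) (⋃ i, S i)) :
    ∃ i, x ∈ @closure X (quasiTopology d) (S i) := by
  let := quasiTopology d
  have hx' : x ∈ closure (⋃ i ∈ {i | ∃ y ∈ S i, d x y < r}, S i) := by
    rw [h.mem_closure] at hx ⊢
    intro s hs
    obtain ⟨y, hy, hxy⟩ := hx (min r s) (lt_min hr hs)
    obtain ⟨i, hi⟩ := Set.mem_iUnion.1 hy
    have hir : i ∈ {i | ∃ y ∈ S i, d x y < r} := ⟨y, hi, hxy.trans_le (min_le_left _ _)⟩
    exact ⟨y, Set.mem_biUnion hir hi, hxy.trans_le (min_le_right _ _)⟩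
  rw [hfin.closure_biUnion] at hx'
  obtain ⟨i, -, hi⟩ := Set.mem_iUnion₂.1 hx'
  exact ⟨i, hi⟩

end IsAdmissible

-- Counting separated points.

/-- Each step covers a ball by at most `N` balls of 3/4 the radius. Since `GeomDoubling` uses strict
separation, a maximal `R / 2`-separated set only gives distances `≤ R / 2`; a factor above 1/2 makes
the covering balls strict. -/
theorem GeomDoubling.finset_card_le {N : ℕ} (hN : GeomDoubling d N) (hd : IsQuasiDist A₀ d)
    (hA : 1 ≤ A₀) {s : ℝ} (j : ℕ) : ∀ (x : X) (R : ℝ) (S : Finset X), (S : Set X) ⊆ ball d x R →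
      (S : Set X).Pairwise (fun y z => s ≤ d y z) → 2 * A₀ * R * (3 / 4) ^ j ≤ s →
      S.card ≤ N ^ j := by
  classical
  induction j with
  | zero =>
    intro x R S hS hsep hR
    rw [pow_zero, Finset.card_le_one]
    intro a ha b hb
    by_contra hab
    have h1 := hsep ha hb hab
    have h2 : d a x < R := by rw [hd.symm]; exact hS ha
    have h3 := hd.triangle_lt hA h2 (hS hb)
    linarith
  | succ j ih =>
    intro x R S hS hsep hR
    obtain ⟨T, hT⟩ := ((S.powerset.filter
      fun T : Finset X => (T : Set X).Pairwise (fun y z => R / 2 < d y z)).exists_maximal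
        ⟨∅, by simp⟩)
    have hTS : T ⊆ S := by simpa using (Finset.mem_filter.1 hT.1).1
    have hTsep := (Finset.mem_filter.1 hT.1).2
    have hTN : T.card ≤ N := hN x R T ((Finset.coe_subset.2 hTS).trans hS) hTsep
    have hcov : S ⊆ T.biUnion fun t => S.filter fun y => d t y < 3 / 4 * R := by
      intro y hy
      have hRpos : 0 < R := (hd.nonneg x y).trans_lt (hS hy)
      rw [Finset.mem_biUnion]
      by_contra hcon
      push Not at hcon
      have hfar : ∀ t ∈ T, R / 2 < d t y := by
        intro t ht
        have := hcon t ht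
        rw [Finset.mem_filter] at this
        push Not at this
        linarith [this hy]
      have hins : insert y T ∈ S.powerset.filter
          fun T : Finset X => (T : Set X).Pairwise (fun y z => R / 2 < d y z) := by
        rw [Finset.mem_filter, Finset.mem_powerset]
        refine ⟨Finset.insert_subset hy hTS, ?_⟩
        rw [Finset.coe_insert]
        refine hTsep.insert fun t ht _ => ⟨?_, hfar t ht⟩
        rw [hd.symm]
        exact hfar t ht
      have hyT : y ∈ T := hT.2 hins (Finset.subset_insert y T) (Finset.mem_insert_self y T)
      have := hfar y hyT
      rw [hd.self] at this
      linarith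
    calc S.card ≤ _ := Finset.card_le_card hcov
      _ ≤ T.card * N ^ j := by
          refine Finset.card_biUnion_le_card_mul _ _ _ fun t _ => ih t (3 / 4 * R) _ ?_ ?_ ?_
          · intro y hy
            exact (Finset.mem_filter.1 hy).2
          · exact hsep.mono fun y hy => (Finset.mem_filter.1 hy).1
          · rw [pow_succ] at hR
            linarith
      _ ≤ N ^ (j + 1) := by
          rw [pow_succ, mul_comm]
          exact Nat.mul_le_mul_left _ hTN

theorem GeomDoubling.encard_le {N : ℕ} (hN : GeomDoubling d N) (hd : IsQuasiDist A₀ d)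
    (hA : 1 ≤ A₀) {s R : ℝ} {j : ℕ} {x : X} {S : Set X} (hS : S ⊆ ball d x R)
    (hsep : S.Pairwise (fun y z => s ≤ d y z)) (hR : 2 * A₀ * R * (3 / 4) ^ j ≤ s) :
    S.encard ≤ (N ^ j : ℕ) := by
  by_contra! hcon
  obtain ⟨T, hTS, hT⟩ := Set.exists_subset_encard_eq (Order.add_one_le_of_lt hcon)
  have hfin : T.Finite := Set.finite_of_encard_eq_coe (k := N ^ j + 1) (by rw [hT]; norm_cast)
  have := hN.finset_card_le hd hA j x R hfin.toFinset
    (by simpa using hTS.trans hS) (by simpa using hsep.mono hTS) hR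
  rw [hfin.encard_eq_coe_toFinset_card] at hT
  norm_cast at hT
  omega

theorem GeomDoubling.finite {N : ℕ} (hN : GeomDoubling d N) (hd : IsQuasiDist A₀ d)
    (hA : 1 ≤ A₀) {s R : ℝ} (hs : 0 < s) {x : X} {S : Set X} (hS : S ⊆ ball d x R)
    (hsep : S.Pairwise (fun y z => s ≤ d y z)) : S.Finite := by
  obtain ⟨j, hj⟩ := exists_pow_lt_of_lt_one (div_pos hs (by positivity : 0 < 2 * A₀ * |R| + 1))
    (by norm_num : (3 / 4 : ℝ) < 1)
  rw [lt_div_iff₀ (by positivity)] at hj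
  refine Set.finite_of_encard_le_coe (hN.encard_le hd hA (j := j) hS hsep ?_)
  have h1 : 2 * A₀ * R ≤ 2 * A₀ * |R| + 1 := by
    nlinarith [le_abs_self R]
  nlinarith [pow_pos (by norm_num : (0 : ℝ) < 3 / 4) j]

theorem IsMaxSeparated.exists_near (hd : IsQuasiDist A₀ d) {r : ℝ} (hr : 0 < r) {Y S : Set X}
    (h : IsMaxSeparated d r Y S) {y : X} (hy : y ∈ Y) : ∃ s ∈ S, d y s < r := by
  by_contra! hcon
  have hmem : y ∈ S := by
    refine h.2 (y := insert y S) ⟨Set.insert_subset hy h.1.1, h.1.2.insert fun s hs _ =>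
      ⟨hcon s hs, ?_⟩⟩ (Set.subset_insert y S) (Set.mem_insert y S)
    rw [hd.symm]
    exact hcon s hs
  have := hcon y hmem
  rw [hd.self] at this
  linarith

-- Reference points.

/-- The conditions on the reference points in the definition of a reference system. -/
structure IsPointSystem (d : X → X → ℝ) (δ : ℝ) (pts : ℤ → Set X) : Prop where
  zero : IsMaxSeparated d 1 Set.univ (pts 0)
  pos : ∀ n : ℕ, pts n ⊆ pts (n + 1) ∧
    IsMaxSeparated d (δ ^ ((n : ℤ) + 1)) Set.univ (pts (n + 1))
  neg : ∀ n : ℕ,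
    IsMaxSeparated d (δ ^ (-((n : ℤ) + 1))) (pts (-(n : ℤ))) (pts (-((n : ℤ) + 1)))

namespace IsPointSystem

variable {pts : ℤ → Set X}

theorem mono (R : IsPointSystem d δ pts) (k : ℤ) : pts k ⊆ pts (k + 1) := by
  cases k with
  | ofNat n => exact (R.pos n).1
  | negSucc n =>
    have h := (R.neg n).1.1
    have e1 : Int.negSucc n = -((n : ℤ) + 1) := by omega
    have e2 : Int.negSucc n + 1 = -(n : ℤ) := by omega
    rw [e2, e1]
    exact h

theorem separated (R : IsPointSystem d δ pts) (k : ℤ) :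
    (pts k).Pairwise (fun x y => δ ^ k ≤ d x y) := by
  cases k with
  | ofNat n =>
    cases n with
    | zero => simpa using R.zero.1.2
    | succ n => exact (R.pos n).2.1.2
  | negSucc n =>
    have e1 : Int.negSucc n = -((n : ℤ) + 1) := by omega
    rw [e1]
    exact (R.neg n).1.2

theorem exists_near (R : IsPointSystem d δ pts) (h : IsAdmissible d A₀ δ) (n : ℕ) (x : X) :
    ∃ α ∈ pts n, d x α < δ ^ (n : ℤ) := by
  cases n with
  | zero => simpa using R.zero.exists_near h.dist one_pos (Set.mem_univ x)
  | succ n => exact (R.pos n).2.exists_near h.dist (h.zpow_pos _) (Set.mem_univ x)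

theorem exists_near_succ (R : IsPointSystem d δ pts) (h : IsAdmissible d A₀ δ) (k : ℤ) {x : X}
    (hx : x ∈ pts (k + 1)) : ∃ α ∈ pts k, d x α < δ ^ k := by
  cases k with
  | ofNat n => exact R.exists_near h n x
  | negSucc n =>
    have e1 : Int.negSucc n = -((n : ℤ) + 1) := by omega
    have e2 : Int.negSucc n + 1 = -(n : ℤ) := by omega
    rw [e2] at hx
    rw [e1]
    exact (R.neg n).exists_near h.dist (h.zpow_pos _) hx

end IsPointSystem

namespace ReferenceSystem

variable (R : ReferenceSystem d A₀ δ)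

theorem isPointSystem : IsPointSystem d δ R.pts := ⟨R.pts_zero, R.pts_pos, R.pts_neg⟩

theorem pts_mono (k : ℤ) : R.pts k ⊆ R.pts (k + 1) := R.isPointSystem.mono k

theorem pts_separated (k : ℤ) : (R.pts k).Pairwise (fun x y => δ ^ k ≤ d x y) :=
  R.isPointSystem.separated k

theorem exists_pt_near (h : IsAdmissible d A₀ δ) (k : ℤ) (x : X) :
    ∃ α ∈ R.pts k, d x α < 2 * A₀ * δ ^ k := by
  have hA := h.one_le
  have key : ∀ n : ℕ, ∃ α ∈ R.pts (-(n : ℤ)), d x α < 2 * A₀ * δ ^ (-(n : ℤ)) := by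
    intro n
    -- For negative generations maximality is only relative to the previous set. The errors do not
    -- accumulate, because `A₀ (2 A₀ δ + 1) ≤ 2 A₀`.
    induction n with
    | zero =>
      obtain ⟨α, hα, hxα⟩ := R.pts_zero.exists_near h.dist one_pos (Set.mem_univ x)
      refine ⟨α, by simpa using hα, ?_⟩
      simp only [Nat.cast_zero, neg_zero, zpow_zero]
      linarith
    | succ n ih =>
      obtain ⟨α, hα, hxα⟩ := ih
      obtain ⟨β, hβ, hαβ⟩ := (R.pts_neg n).exists_near h.dist (h.zpow_pos _) hα
      refine ⟨β, by simpa using hβ, ?_⟩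
      have h1 := h.dist.triangle_lt hA hxα hαβ
      have h2 := h.zpow_succ (-((n : ℤ) + 1))
      rw [show -((n : ℤ) + 1) + 1 = -(n : ℤ) by ring] at h2
      have h3 := h.pow_mul_le (j := 1) (by norm_num)
      have h4 := h.zpow_pos (-((n : ℤ) + 1))
      rw [h2] at h1
      push_cast
      refine h1.trans_le ?_
      have h5 : 2 * A₀ * (δ ^ (-((n : ℤ) + 1)) * δ) + δ ^ (-((n : ℤ) + 1)) ≤
          2 * δ ^ (-((n : ℤ) + 1)) := by nlinarith
      nlinarith
  cases k with
  | ofNat n =>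
    have hpos := h.zpow_pos (Int.ofNat n)
    obtain ⟨α, hα, hxα⟩ := R.isPointSystem.exists_near h n x
    exact ⟨α, hα, hxα.trans_le (le_mul_of_one_le_left hpos.le (by linarith))⟩
  | negSucc n =>
    have e1 : Int.negSucc n = -((n + 1 : ℕ) : ℤ) := by omega
    rw [e1]
    exact key (n + 1)

theorem finite_pts_near (h : IsAdmissible d A₀ δ) {N : ℕ} (hN : GeomDoubling d N) (k : ℤ) (x : X)
    (r : ℝ) : {α : R.pts k | d x α < r}.Finite := by
  have h1 : (R.pts k ∩ ball d x r).Finite :=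
    hN.finite h.dist h.one_le (h.zpow_pos k) Set.inter_subset_right
      ((R.pts_separated k).mono Set.inter_subset_left)
  refine (h1.preimage (f := ((↑) : R.pts k → X)) Subtype.val_injective.injOn).subset ?_
  intro α hα
  exact ⟨α.2, hα⟩

/-- The point `x^k_α`, seen as a point of the next generation, is a child of `(k, α)`. -/
theorem parent_self (h : IsAdmissible d A₀ δ) (k : ℤ) (α : R.pts k) :
    R.parent k ⟨α, R.pts_mono k α.2⟩ = α := by
  apply R.parent_of_near
  have := h.A_pos
  have := h.zpow_pos k
  rw [h.dist.self]
  positivity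

end ReferenceSystem

-- New points and the new order.

namespace DyadicSystem

variable (D : DyadicSystem d A₀ δ)

theorem exists_child_eq_newPt (h : IsAdmissible d A₀ δ) (ω : D.Param) (k : ℤ) (α : D.pts k) :
    ∃ β : D.pts (k + 1), D.parent k β = α ∧ D.newPt ω k α = β := by
  unfold newPt
  split_ifs with hc
  · exact ⟨_, hc.2.choose_spec.1, rfl⟩
  · exact ⟨⟨α, D.pts_mono k α.2⟩, D.parent_self h k α, rfl⟩

theorem newPt_eq_or (ω : D.Param) (k : ℤ) (α : D.pts k) :
    D.newPt ω k α = α ∨ D.label₁ k α = (ω k).1 := by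
  unfold newPt
  split_ifs with hc
  · exact Or.inr hc.1
  · exact Or.inl rfl

theorem newPt_of_label (ω : D.Param) (k : ℤ) (β : D.pts (k + 1))
    (hω : ω k = (D.label₁ k (D.parent k β), D.label₂ (k + 1) β)) :
    D.newPt ω k (D.parent k β) = β := by
  have hc : D.label₁ k (D.parent k β) = (ω k).1 ∧ ∃ γ : D.pts (k + 1),
      D.parent k γ = D.parent k β ∧ D.label₂ (k + 1) γ = (ω k).2 := by
    rw [hω]
    exact ⟨rfl, β, rfl, rfl⟩
  unfold newPt
  rw [dif_pos hc]
  have hspec := hc.2.choose_spec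
  by_contra hne
  refine D.label₂_ne k _ β (fun he => hne (congrArg _ he)) hspec.1 ?_
  rw [hspec.2, hω]

theorem dist_newPt (h : IsAdmissible d A₀ δ) (ω : D.Param) (k : ℤ) (α : D.pts k) :
    d α (D.newPt ω k α) < 2 * A₀ * δ ^ k := by
  obtain ⟨β, rfl, hβ⟩ := D.exists_child_eq_newPt h ω k α
  rw [hβ, h.dist.symm]
  exact D.dist_parent k β

theorem le_dist_newPt (h : IsAdmissible d A₀ δ) (ω : D.Param) (k : ℤ) {α β : D.pts k}
    (hne : α ≠ β) : 1 / (2 * A₀) * δ ^ k ≤ d α (D.newPt ω k β) := by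
  obtain ⟨γ, rfl, hγ⟩ := D.exists_child_eq_newPt h ω k β
  by_contra! hlt
  rw [hγ, h.dist.symm] at hlt
  exact hne (D.parent_of_near k γ α hlt).symm

/-- If one of the two points did not move, the other is a child of a different parent and so not
near it. If both carry the selected label, they are not neighbours, so their children are apart. -/
theorem newPt_separated (h : IsAdmissible d A₀ δ) (ω : D.Param) (k : ℤ) {α β : D.pts k}
    (hne : α ≠ β) : 1 / (2 * A₀) * δ ^ k ≤ d (D.newPt ω k α) (D.newPt ω k β) := by
  obtain ⟨γ, hγα, hγ⟩ := D.exists_child_eq_newPt h ω k α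
  obtain ⟨η, hηβ, hη⟩ := D.exists_child_eq_newPt h ω k β
  rcases D.newPt_eq_or ω k α with hα | hα
  · rw [hα]
    exact D.le_dist_newPt h ω k hne
  rcases D.newPt_eq_or ω k β with hβ | hβ
  · rw [hβ, h.dist.symm]
    exact D.le_dist_newPt h ω k hne.symm
  by_contra! hlt
  rw [hγ, hη, one_div] at hlt
  exact D.label₁_ne k α β ⟨hne, γ, hγα, η, hηβ, hlt⟩ (hα.trans hβ.symm)

theorem newChild_unique (h : IsAdmissible d A₀ δ) {ω : D.Param} {k : ℤ} {β : D.pts (k + 1)}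
    {α α' : D.pts k} (hα : D.NewChild ω k β α) (hα' : D.NewChild ω k β α') : α = α' := by
  rcases hα with hα | ⟨hα, hno⟩
  · rcases hα' with hα' | ⟨-, hno⟩
    · by_contra hne
      rw [h.dist.symm] at hα
      have h1 := h.dist.triangle_lt h.one_le hα hα'
      have h2 := D.newPt_separated h ω k hne
      have h3 := h.A_pos
      have h4 : A₀ * (1 / 4 * (A₀ ^ 2)⁻¹ * δ ^ k + 1 / 4 * (A₀ ^ 2)⁻¹ * δ ^ k) =
          1 / (2 * A₀) * δ ^ k := by
        field_simp
        ring
      linarith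
    · exact absurd ⟨α, hα⟩ hno
  · rcases hα' with hα' | ⟨hα', -⟩
    · exact absurd ⟨α', hα'⟩ hno
    · exact hα.symm.trans hα'

theorem exists_newChild (ω : D.Param) (k : ℤ) (β : D.pts (k + 1)) :
    ∃ α, D.NewChild ω k β α := by
  by_cases hc : ∃ γ : D.pts k, d β (D.newPt ω k γ) < 1 / 4 * (A₀ ^ 2)⁻¹ * δ ^ k
  · exact hc.imp fun γ hγ => Or.inl hγ
  · exact ⟨_, Or.inr ⟨rfl, hc⟩⟩

theorem newChild_self (h : IsAdmissible d A₀ δ) (ω : D.Param) (k : ℤ) (α : D.pts k) :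
    D.NewChild ω k ⟨α, D.pts_mono k α.2⟩ α := by
  by_cases hc : ∃ γ : D.pts k, d α (D.newPt ω k γ) < 1 / 4 * (A₀ ^ 2)⁻¹ * δ ^ k
  · obtain ⟨γ, hγ⟩ := hc
    have : α = γ := by
      by_contra hne
      have h1 := D.le_dist_newPt h ω k hne
      have h2 : 1 / 4 * (A₀ ^ 2)⁻¹ ≤ 1 / (2 * A₀) := by
        have h3 := h.one_le
        rw [← div_eq_mul_inv, div_le_div_iff₀ (by positivity) (by positivity)]
        nlinarith
      have h4 := mul_le_mul_of_nonneg_right h2 (h.zpow_pos k).le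
      linarith
    subst this
    exact Or.inl hγ
  · exact Or.inr ⟨D.parent_self h k α, hc⟩

theorem dist_newPt_of_newChild (h : IsAdmissible d A₀ δ) {ω : D.Param} {k : ℤ} {β : D.pts (k + 1)}
    {α : D.pts k} (hβ : D.NewChild ω k β α) : d β (D.newPt ω k α) < 4 * A₀ ^ 2 * δ ^ k := by
  have hA := h.one_le
  have hpos := h.zpow_pos k
  rcases hβ with hβ | ⟨rfl, -⟩
  · refine hβ.trans_le (mul_le_mul_of_nonneg_right ?_ hpos.le)
    have h1 : (A₀ ^ 2)⁻¹ ≤ 1 := inv_le_one_of_one_le₀ (one_le_pow₀ hA)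
    nlinarith
  · refine (h.dist.triangle_lt hA (D.dist_parent k β) (D.dist_newPt h ω k _)).trans_le
      (le_of_eq (by ring))

theorem dist_newPt_newPt (h : IsAdmissible d A₀ δ) {ω : D.Param} {k : ℤ} {β : D.pts (k + 1)}
    {α : D.pts k} (hβ : D.NewChild ω k β α) :
    d (D.newPt ω k α) (D.newPt ω (k + 1) β) < 401 / 100 * A₀ ^ 3 * δ ^ k := by
  have hA := h.one_le
  have hpos := h.zpow_pos k
  have h1 := D.dist_newPt_of_newChild h hβ
  rw [h.dist.symm] at h1
  refine (h.dist.triangle_lt hA h1 (D.dist_newPt h ω (k + 1) β)).trans_le ?_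
  rw [h.zpow_succ]
  have h2 := h.pow_mul_le (j := 1) (by norm_num)
  have h3 : 1 ≤ A₀ ^ 2 := one_le_pow₀ hA
  have h4 : A₀ * (4 * A₀ ^ 2 * δ ^ k + 2 * A₀ * (δ ^ k * δ)) =
    A₀ * δ ^ k * (4 * A₀ ^ 2 + 2 * (A₀ ^ 1 * δ)) := by ring
  have h5 : 401 / 100 * A₀ ^ 3 * δ ^ k = A₀ * δ ^ k * (401 / 100 * A₀ ^ 2) := by ring
  rw [h4, h5]
  exact mul_le_mul_of_nonneg_left (by linarith) (by positivity)

theorem newLE_cases {ω : D.Param} {p : Σ k : ℤ, D.pts k} {k : ℤ} {α : D.pts k}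
    (hp : D.NewLE ω p ⟨k, α⟩) :
    p = ⟨k, α⟩ ∨ ∃ γ : D.pts (k + 1), D.NewLE ω p ⟨k + 1, γ⟩ ∧ D.NewChild ω k γ α := by
  rcases Relation.ReflTransGen.cases_tail hp with heq | ⟨c, hpc, l, β, γ, rfl, hγ, hβγ⟩
  · exact Or.inl heq.symm
  · cases hγ
    exact Or.inr ⟨β, hpc, hβγ⟩

theorem NewChild.newLE {D : DyadicSystem d A₀ δ} {ω : D.Param} {k : ℤ} {β : D.pts (k + 1)}
    {α : D.pts k} (hβ : D.NewChild ω k β α) : D.NewLE ω ⟨k + 1, β⟩ ⟨k, α⟩ :=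
  Relation.ReflTransGen.single ⟨k, β, α, rfl, rfl, hβ⟩

theorem NewLE.trans {D : DyadicSystem d A₀ δ} {ω : D.Param} {p q r : Σ k : ℤ, D.pts k}
    (hpq : D.NewLE ω p q) (hqr : D.NewLE ω q r) : D.NewLE ω p r :=
  Relation.ReflTransGen.trans hpq hqr

theorem NewLE.eq_or_lt {D : DyadicSystem d A₀ δ} {ω : D.Param} {p q : Σ k : ℤ, D.pts k}
    (hpq : D.NewLE ω p q) : p = q ∨ q.1 < p.1 := by
  induction hpq with
  | refl => exact Or.inl rfl
  | tail _ hs ih =>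
    obtain ⟨k, β, α, rfl, rfl, -⟩ := hs
    right
    rcases ih with rfl | ih
    · exact lt_add_one k
    · exact (lt_add_one k).trans ih

theorem newLE_succ_iff {ω : D.Param} {k : ℤ} {β : D.pts (k + 1)} {α : D.pts k} :
    D.NewLE ω ⟨k + 1, β⟩ ⟨k, α⟩ ↔ D.NewChild ω k β α := by
  refine ⟨fun hle => ?_, NewChild.newLE⟩
  rcases D.newLE_cases hle with heq | ⟨γ, hγ, hγα⟩
  · have := congrArg Sigma.fst heq
    simp at this
  · rcases hγ.eq_or_lt with heq | hlt
    · cases heq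
      exact hγα
    · exact absurd hlt (lt_irrefl _)

/-- One-step ancestors are unique, so the ancestors of a pair form a chain, which meets each
generation at most once. -/
theorem NewLE.unique {D : DyadicSystem d A₀ δ} (h : IsAdmissible d A₀ δ) {ω : D.Param}
    {p : Σ k : ℤ, D.pts k} {k : ℤ} {α β : D.pts k} (hα : D.NewLE ω p ⟨k, α⟩)
    (hβ : D.NewLE ω p ⟨k, β⟩) : α = β := by
  have huniq : Relator.RightUnique fun p q : Σ k : ℤ, D.pts k =>
      ∃ (k : ℤ) (β : D.pts (k + 1)) (α : D.pts k),
        p = ⟨k + 1, β⟩ ∧ q = ⟨k, α⟩ ∧ D.NewChild ω k β α := by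
    rintro p q r ⟨k, β, α, rfl, rfl, hβα⟩ ⟨l, γ, θ, hp, rfl, hγθ⟩
    obtain rfl : k = l := by simpa using congrArg Sigma.fst hp
    cases hp
    rw [D.newChild_unique h hβα hγθ]
  rcases Relation.ReflTransGen.total_of_right_unique huniq hα hβ with hle | hle
  · rcases NewLE.eq_or_lt hle with heq | hlt
    · cases heq
      rfl
    · exact absurd hlt (lt_irrefl _)
  · rcases NewLE.eq_or_lt hle with heq | hlt
    · cases heq
      rfl
    · exact absurd hlt (lt_irrefl _)

theorem NewLE.dist_lt {D : DyadicSystem d A₀ δ} (h : IsAdmissible d A₀ δ) {ω : D.Param}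
    {p q : Σ k : ℤ, D.pts k} (hpq : D.NewLE ω p q) :
    d (D.newPt ω q.1 q.2) (D.newPt ω p.1 p.2) < 5 * A₀ ^ 4 * δ ^ q.1 := by
  have hA := h.A_pos
  induction hpq with
  | refl =>
    rw [h.dist.self]
    have := h.zpow_pos p.1
    positivity
  | tail _ hs ih =>
    obtain ⟨k, β, α, rfl, rfl, hβα⟩ := hs
    -- The induction runs towards coarser generations, so the bound already obtained carries a
    -- factor `δ` that pays for the new `A₀`.
    refine (h.dist.triangle_lt h.one_le (D.dist_newPt_newPt h hβα) ih).trans_le ?_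
    have hpos := h.zpow_pos k
    have h2 := h.pow_mul_le (j := 1) (by norm_num)
    simp only [h.zpow_succ]
    have h4 : A₀ * (401 / 100 * A₀ ^ 3 * δ ^ k + 5 * A₀ ^ 4 * (δ ^ k * δ)) =
      A₀ ^ 4 * δ ^ k * (401 / 100 + 5 * (A₀ ^ 1 * δ)) := by ring
    have h5 : 5 * A₀ ^ 4 * δ ^ k = A₀ ^ 4 * δ ^ k * 5 := by ring
    rw [h4, h5]
    exact mul_le_mul_of_nonneg_left (by linarith) (by positivity)

-- The cubes for a fixed parameter.

theorem preCube_mono {ω : D.Param} {k l : ℤ} {α : D.pts k} {β : D.pts l}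
    (hle : D.NewLE ω ⟨l, β⟩ ⟨k, α⟩) : D.preCube ω l β ⊆ D.preCube ω k α := by
  rintro _ ⟨m, γ, hγ, rfl⟩
  exact ⟨m, γ, hγ.trans hle, rfl⟩

theorem closedCube_mono {ω : D.Param} {k l : ℤ} {α : D.pts k} {β : D.pts l}
    (hle : D.NewLE ω ⟨l, β⟩ ⟨k, α⟩) : D.closedCube ω l β ⊆ D.closedCube ω k α :=
  @closure_mono X (quasiTopology d) _ _ (D.preCube_mono hle)

theorem openCube_mono {ω : D.Param} {k l : ℤ} {α : D.pts k} {β : D.pts l}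
    (hle : D.NewLE ω ⟨l, β⟩ ⟨k, α⟩) : D.openCube ω l β ⊆ D.openCube ω k α :=
  @interior_mono X (quasiTopology d) _ _ (D.closedCube_mono hle)

theorem openCube_subset (ω : D.Param) (k : ℤ) (α : D.pts k) :
    D.openCube ω k α ⊆ D.closedCube ω k α :=
  @interior_subset X (quasiTopology d) _

/-- Only finitely many preliminary cubes of a generation come near a given point. -/
theorem finite_preCube_near (h : IsAdmissible d A₀ δ) {N : ℕ} (hN : GeomDoubling d N) (ω : D.Param)
    (k : ℤ) (x : X) : {α : D.pts k | ∃ y ∈ D.preCube ω k α, d x y < 1}.Finite := by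
  refine (D.finite_pts_near h hN k x
    (A₀ * (1 + A₀ * (5 * A₀ ^ 4 * δ ^ k + 2 * A₀ * δ ^ k)))).subset ?_
  rintro α ⟨_, ⟨l, β, hβ, rfl⟩, hy⟩
  have h1 := NewLE.dist_lt h hβ
  have h2 := D.dist_newPt h ω k α
  rw [h.dist.symm] at h1 h2
  exact h.dist.triangle_lt h.one_le hy (h.dist.triangle_lt h.one_le h1 h2)

theorem exists_self_newLE (h : IsAdmissible d A₀ δ) (ω : D.Param) (k : ℤ) (α : D.pts k) (n : ℕ) :
    ∃ l : ℤ, l = k + n ∧ ∃ hl : (α : X) ∈ D.pts l, D.NewLE ω ⟨l, ⟨α, hl⟩⟩ ⟨k, α⟩ := by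
  induction n with
  | zero => exact ⟨k, by simp, α.2, Relation.ReflTransGen.refl⟩
  | succ n ih =>
    obtain ⟨l, hl, hα, hle⟩ := ih
    exact ⟨l + 1, by push_cast; omega, D.pts_mono l hα,
      (D.newChild_self h ω l ⟨α, hα⟩).newLE.trans hle⟩

/-- A reference point persists in all later generations as its own descendant, and its new points
converge to it. -/
theorem pt_mem_closedCube (h : IsAdmissible d A₀ δ) (ω : D.Param) (k : ℤ) (α : D.pts k) :
    (α : X) ∈ D.closedCube ω k α := by
  refine h.mem_closure.2 fun r hr => ?_
  have hA := h.A_pos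
  obtain ⟨n, hn⟩ := h.exists_zpow_lt k (r := r / (2 * A₀)) (by positivity)
  obtain ⟨l, hl, hα, hle⟩ := D.exists_self_newLE h ω k α n
  refine ⟨_, ⟨l, _, hle, rfl⟩, (D.dist_newPt h ω l ⟨α, hα⟩).trans ?_⟩
  rw [← hl, lt_div_iff₀ (by positivity)] at hn
  linarith

theorem mem_closedCube_iff (h : IsAdmissible d A₀ δ) {N : ℕ} (hN : GeomDoubling d N)
    {ω : D.Param} {k : ℤ} {α : D.pts k} {x : X} : x ∈ D.closedCube ω k α ↔
      ∃ β : D.pts (k + 1), D.NewChild ω k β α ∧ x ∈ D.closedCube ω (k + 1) β := by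
  refine ⟨fun hx => ?_, fun ⟨β, hβ, hx⟩ => D.closedCube_mono hβ.newLE hx⟩
  have hsub : D.preCube ω k α ⊆ @closure X (quasiTopology d)
      -- The only point not coming from a child's preliminary cube is `z^k_α` itself; it is a
      -- reference point of generation `k + 1` at distance zero from `z^k_α`, so it lies in the
      -- closed cube of a new child.
      (⋃ β : {β : D.pts (k + 1) // D.NewChild ω k β α}, D.preCube ω (k + 1) β.1) := by
    rintro _ ⟨l, γ, hγ, rfl⟩
    rcases D.newLE_cases hγ with heq | ⟨β, hβ, hβα⟩
    · cases heq
      obtain ⟨β, -, hβ⟩ := D.exists_child_eq_newPt h ω k α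
      have hβα : D.NewChild ω k β α := by
        left
        rw [hβ, h.dist.self]
        have := h.A_pos
        have := h.zpow_pos k
        positivity
      rw [hβ]
      exact (@closure_mono X (quasiTopology d) _ _
        (Set.subset_iUnion (fun β : {β : D.pts (k + 1) // D.NewChild ω k β α} =>
          D.preCube ω (k + 1) β.1) ⟨β, hβα⟩)) (D.pt_mem_closedCube h ω (k + 1) β)
    · exact (@subset_closure X (quasiTopology d) _)
        (Set.mem_iUnion.2 ⟨⟨β, hβα⟩, l, γ, hβ, rfl⟩)
  have hx' := (@closure_minimal X (quasiTopology d) _ _ hsub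
    (@isClosed_closure X (quasiTopology d) _)) hx
  have hfin : {β : {β : D.pts (k + 1) // D.NewChild ω k β α} |
      ∃ y ∈ D.preCube ω (k + 1) β.1, d x y < 1}.Finite :=
    (D.finite_preCube_near h hN ω (k + 1) x).preimage
      (f := fun β : {β : D.pts (k + 1) // D.NewChild ω k β α} => β.1) Subtype.val_injective.injOn
  obtain ⟨β, hβ⟩ := h.exists_mem_closure_of_finite one_pos hfin hx'
  exact ⟨β.1, β.2, hβ⟩

theorem exists_ancestor (ω : D.Param) (k : ℤ) (n : ℕ) : ∀ (l : ℤ), l = k + n → ∀ β : D.pts l,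
    ∃ α : D.pts k, D.NewLE ω ⟨l, β⟩ ⟨k, α⟩ := by
  induction n with
  | zero =>
    intro l hl β
    obtain rfl : l = k := by simpa using hl
    exact ⟨β, Relation.ReflTransGen.refl⟩
  | succ n ih =>
    intro l hl β
    obtain rfl : l = (k + n) + 1 := by rw [hl]; push_cast; ring
    obtain ⟨γ, hγ⟩ := D.exists_newChild ω (k + n) β
    obtain ⟨α, hα⟩ := ih _ rfl γ
    exact ⟨α, hγ.newLE.trans hα⟩

theorem exists_mem_closedCube (h : IsAdmissible d A₀ δ) {N : ℕ} (hN : GeomDoubling d N)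
    (ω : D.Param) (k : ℤ) (x : X) : ∃ α, x ∈ D.closedCube ω k α := by
  refine h.exists_mem_closure_of_finite one_pos (D.finite_preCube_near h hN ω k x) ?_
  refine h.mem_closure.2 fun r hr => ?_
  have hA := h.A_pos
  obtain ⟨n, hn⟩ := h.exists_zpow_lt k (r := r / (4 * A₀ ^ 2)) (by positivity)
  obtain ⟨β, hβ, hxβ⟩ := D.exists_pt_near h (k + n) x
  obtain ⟨α, hα⟩ := D.exists_ancestor ω k n _ rfl ⟨β, hβ⟩
  refine ⟨_, Set.mem_iUnion.2 ⟨α, _, _, hα, rfl⟩,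
    (h.dist.triangle_lt h.one_le hxβ (D.dist_newPt h ω (k + n) ⟨β, hβ⟩)).trans ?_⟩
  rw [lt_div_iff₀ (by positivity)] at hn
  linarith

theorem dist_lt_of_mem_closedCube (h : IsAdmissible d A₀ δ) {N : ℕ} (hN : GeomDoubling d N)
    {ω : D.Param} {k : ℤ} {α : D.pts k} {x : X} (hx : x ∈ D.closedCube ω k α) :
    d (D.newPt ω k α) x < 6 * A₀ ^ 4 * δ ^ k := by
  have hA := h.A_pos
  -- Taking the closure costs a further `A₀`. Descending to a child beforehand lets `δ` absorb it.
  obtain ⟨β, hβ, hxβ⟩ := (D.mem_closedCube_iff h hN).1 hx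
  have hpos := h.zpow_pos (k + 1)
  obtain ⟨_, ⟨l, γ, hγ, rfl⟩, hy⟩ :=
    h.mem_closure.1 hxβ (A₀ ^ 4 * δ ^ (k + 1)) (by positivity)
  rw [h.dist.symm] at hy
  have h1 := h.dist.triangle_lt h.one_le (NewLE.dist_lt h hγ) hy
  refine (h.dist.triangle_lt h.one_le (D.dist_newPt_newPt h hβ) h1).trans_le ?_
  have hpos := h.zpow_pos k
  have h2 := h.pow_mul_le (j := 2) (by norm_num)
  simp only [h.zpow_succ]
  have h4 : A₀ * (401 / 100 * A₀ ^ 3 * δ ^ k +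
      A₀ * (5 * A₀ ^ 4 * (δ ^ k * δ) + A₀ ^ 4 * (δ ^ k * δ))) =
    A₀ ^ 4 * δ ^ k * (401 / 100 + 6 * (A₀ ^ 2 * δ)) := by ring
  have h5 : 6 * A₀ ^ 4 * δ ^ k = A₀ ^ 4 * δ ^ k * 6 := by ring
  rw [h4, h5]
  exact mul_le_mul_of_nonneg_left (by linarith) (by positivity)

/-- A cube of the next generation that comes near `z^k_α` descends from `(k, α)`. -/
theorem newChild_of_mem_closedCube (h : IsAdmissible d A₀ δ) {N : ℕ} (hN : GeomDoubling d N)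
    {ω : D.Param} {k : ℤ} {α : D.pts k} {β : D.pts (k + 1)} {x : X}
    (hx : x ∈ D.closedCube ω (k + 1) β)
    (hαx : d (D.newPt ω k α) x < 1 / 5 * (A₀ ^ 4)⁻¹ * δ ^ k) : D.NewChild ω k β α := by
  left
  have hA := h.A_pos
  have h1 := D.dist_lt_of_mem_closedCube h hN hx
  rw [h.dist.symm] at hαx
  refine (h.dist.triangle_lt h.one_le (D.dist_newPt h ω (k + 1) β)
    (h.dist.triangle_lt h.one_le h1 hαx)).trans_le ?_
  rw [h.zpow_succ]
  have h2 := h.pow_mul_le (j := 8) (by norm_num)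
  -- The given distance contributes 1/5 after two quasi-triangle inequalities; the margin up to 1/4
  -- absorbs the two terms containing `δ`.
  have h3 := h.pow_mul_le (j := 4) (by norm_num)
  have hpos := h.zpow_pos k
  have h4 : A₀ * (2 * A₀ * (δ ^ k * δ) +
      A₀ * (6 * A₀ ^ 4 * (δ ^ k * δ) + 1 / 5 * (A₀ ^ 4)⁻¹ * δ ^ k)) =
      (A₀ ^ 2)⁻¹ * δ ^ k * (2 * (A₀ ^ 4 * δ) + 6 * (A₀ ^ 8 * δ) + 1 / 5) := by
    field_simp
    ring
  have h5 : 1 / 4 * (A₀ ^ 2)⁻¹ * δ ^ k = (A₀ ^ 2)⁻¹ * δ ^ k * (1 / 4) := by ring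
  rw [h4, h5]
  exact mul_le_mul_of_nonneg_left (by linarith) (by positivity)

theorem ball_subset_closedCube (h : IsAdmissible d A₀ δ) {N : ℕ} (hN : GeomDoubling d N)
    (ω : D.Param) (k : ℤ) (α : D.pts k) :
    ball d (D.newPt ω k α) (1 / 5 * (A₀ ^ 4)⁻¹ * δ ^ k) ⊆ D.closedCube ω k α := by
  intro x hx
  obtain ⟨β, hβ⟩ := D.exists_mem_closedCube h hN ω (k + 1) x
  exact D.closedCube_mono (D.newChild_of_mem_closedCube h hN hβ hx).newLE hβ

theorem ball_subset_openCube (h : IsAdmissible d A₀ δ) {N : ℕ} (hN : GeomDoubling d N)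
    (ω : D.Param) (k : ℤ) (α : D.pts k) :
    ball d (D.newPt ω k α) (1 / 6 * (A₀ ^ 5)⁻¹ * δ ^ k) ⊆ D.openCube ω k α := by
  intro x hx
  have hA := h.A_pos
  have hpos := h.zpow_pos k
  -- The radius is chosen so that 1/6 + 1/30 = 1/5.
  refine h.mem_interior.2 ⟨1 / 30 * (A₀ ^ 5)⁻¹ * δ ^ k, by positivity, fun y hy =>
    D.ball_subset_closedCube h hN ω k α ?_⟩
  refine (h.dist.triangle_lt h.one_le hx hy).trans_le (le_of_eq ?_)
  field_simp
  norm_num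

theorem exists_descendant (h : IsAdmissible d A₀ δ) {N : ℕ} (hN : GeomDoubling d N)
    {ω : D.Param} {k : ℤ} {α : D.pts k} {x : X} (hx : x ∈ D.closedCube ω k α) (n : ℕ) :
    ∃ l : ℤ, l = k + n ∧ ∃ β : D.pts l, D.NewLE ω ⟨l, β⟩ ⟨k, α⟩ ∧ x ∈ D.closedCube ω l β := by
  induction n with
  | zero => exact ⟨k, by simp, α, Relation.ReflTransGen.refl, hx⟩
  | succ n ih =>
    obtain ⟨l, hl, β, hβ, hxβ⟩ := ih
    obtain ⟨γ, hγ, hxγ⟩ := (D.mem_closedCube_iff h hN).1 hxβ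
    exact ⟨l + 1, by push_cast; omega, γ, hγ.newLE.trans hβ, hxγ⟩

theorem eq_of_mem_closedCube_of_mem_openCube (h : IsAdmissible d A₀ δ) {N : ℕ}
    (hN : GeomDoubling d N) {ω : D.Param} {k : ℤ} {α β : D.pts k} {x : X}
    (hα : x ∈ D.closedCube ω k α) (hβ : x ∈ D.openCube ω k β) : α = β := by
  have hA := h.A_pos
  obtain ⟨r, hr, hsub⟩ := h.mem_interior.1 hβ
  obtain ⟨n, hn⟩ := h.exists_zpow_lt k (r := r / (6 * A₀ ^ 4)) (by positivity)
  obtain ⟨l, rfl, γ, hγα, hxγ⟩ := D.exists_descendant h hN hα n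
  -- A small descendant `γ` of `α` containing `x` has its centre in the cube of `β`. A cube one
  -- generation finer through that centre descends from `β`, but also from `γ`, hence from `α`.
  have hz : D.newPt ω (k + n) γ ∈ D.closedCube ω k β := by
    refine hsub ?_
    have h1 := D.dist_lt_of_mem_closedCube h hN hxγ
    rw [h.dist.symm] at h1
    rw [lt_div_iff₀ (by positivity)] at hn
    change d _ _ < r
    linarith
  obtain ⟨l, hl, θ, hθβ, hzθ⟩ := D.exists_descendant h hN hz (n + 1)
  obtain rfl : l = k + n + 1 := by rw [hl]; push_cast; ring
  have hθγ : D.NewChild ω (k + n) θ γ := by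
    refine D.newChild_of_mem_closedCube h hN hzθ ?_
    rw [h.dist.self]
    have := h.zpow_pos (k + n)
    positivity
  exact (hθγ.newLE.trans hγα).unique h hθβ

end DyadicSystem

-- Decay rates and probability estimates.

/-- A geometric sequence decays at a power rate in terms of another one. -/
theorem exists_rpow_bound {q δ c : ℝ} (hq : 0 < q) (hq1 : q < 1) (hδ : 0 < δ) (hδ1 : δ < 1)
    (hc : 0 < c) : ∃ η C : ℝ, 0 < η ∧ η ≤ 1 ∧ 0 < C ∧ ∀ ε : ℝ, 0 < ε → 1 ≤ C * ε ^ η ∨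
      ∃ n : ℕ, ε ≤ c * δ ^ n ∧ q ^ (n + 1) ≤ C * ε ^ η := by
  have hlq := Real.log_neg hq hq1
  have hlδ := Real.log_neg hδ hδ1
  have hratio : 0 < Real.log q / Real.log δ := div_pos_of_neg_of_neg hlq hlδ
  -- This exponent gives `q ≤ δ ^ η`; below, `n` is the scale with `δ ^ (n + 1) < ε / c ≤ δ ^ n`.
  set η := min 1 (Real.log q / Real.log δ) with hη
  have hη0 : 0 < η := lt_min one_pos hratio
  have hqδ : q ≤ δ ^ η := by
    rw [Real.rpow_def_of_pos hδ, ← Real.log_le_iff_le_exp hq, mul_comm]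
    have := mul_le_mul_of_nonpos_right (min_le_right 1 (Real.log q / Real.log δ)) hlδ.le
    rwa [div_mul_cancel₀ _ hlδ.ne] at this
  refine ⟨η, (c⁻¹) ^ η, hη0, min_le_left _ _, Real.rpow_pos_of_pos (inv_pos.2 hc) _,
    fun ε hε => ?_⟩
  rw [← Real.mul_rpow (inv_pos.2 hc).le hε.le]
  have hpos : 0 < c⁻¹ * ε := mul_pos (inv_pos.2 hc) hε
  rcases le_total 1 (c⁻¹ * ε) with hle | hle
  · exact Or.inl (Real.one_le_rpow hle hη0.le)
  · obtain ⟨n, hn1, hn2⟩ := exists_nat_pow_near_of_lt_one hpos hle hδ hδ1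
    refine Or.inr ⟨n, (inv_mul_le_iff₀ hc).1 hn2, ?_⟩
    calc q ^ (n + 1) ≤ (δ ^ η) ^ (n + 1) := pow_le_pow_left₀ hq.le hqδ _
      _ = (δ ^ (n + 1)) ^ η := by
          rw [← Real.rpow_natCast, ← Real.rpow_mul hδ.le, mul_comm, Real.rpow_mul hδ.le,
            Real.rpow_natCast]
      _ ≤ (c⁻¹ * ε) ^ η := Real.rpow_le_rpow (pow_pos hδ _).le hn1.le hη0.le

namespace ReferenceSystem

variable (R : ReferenceSystem d A₀ δ)

theorem encard_children_le (h : IsAdmissible d A₀ δ) {N : ℕ} (hN : GeomDoubling d N) {j : ℕ}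
    (hj : 10 * A₀ ^ 4 * (3 / 4) ^ j ≤ δ) (k : ℤ) (α : R.pts k) :
    (R.children k α).encard ≤ (N ^ j : ℕ) := by
  rw [← Subtype.val_injective.encard_image]
  have hA := h.one_le
  have hpos := h.zpow_pos k
  refine hN.encard_le h.dist hA (x := α) (R := 2 * A₀ * δ ^ k) (s := δ ^ (k + 1)) ?_
    ((R.pts_separated (k + 1)).mono (by rintro _ ⟨β, -, rfl⟩; exact β.2)) ?_
  · rintro _ ⟨β, rfl, rfl⟩
    change d _ _ < _
    rw [h.dist.symm]
    exact R.dist_parent k β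
  · rw [h.zpow_succ]
    have h1 : A₀ ^ 2 ≤ A₀ ^ 4 := pow_le_pow_right₀ hA (by norm_num)
    have h2 : 0 < (3 / 4 : ℝ) ^ j := by positivity
    have h3 : 4 * A₀ ^ 2 * (3 / 4) ^ j ≤ δ :=
      (mul_le_mul_of_nonneg_right (by nlinarith [sq_nonneg A₀]) h2.le).trans hj
    calc 2 * A₀ * (2 * A₀ * δ ^ k) * (3 / 4) ^ j = δ ^ k * (4 * A₀ ^ 2 * (3 / 4) ^ j) := by ring
      _ ≤ δ ^ k * δ := mul_le_mul_of_nonneg_left h3 hpos.le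

/-- Neighbours lie within `5 A₀ ^ 3 δ ^ k`, which is where the `10 A₀ ^ 4` in the condition on `j`
comes from. The same `j` serves for children, which are only `δ ^ (k + 1)`-separated. -/
theorem encard_neighbours_le (h : IsAdmissible d A₀ δ) {N : ℕ} (hN : GeomDoubling d N) {j : ℕ}
    (hj : 10 * A₀ ^ 4 * (3 / 4) ^ j ≤ δ) (k : ℤ) (α : R.pts k) :
    {β | R.IsNeighbour k α β}.encard ≤ (N ^ j : ℕ) := by
  rw [← Subtype.val_injective.encard_image]
  have hA := h.one_le
  have hpos := h.zpow_pos k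
  refine hN.encard_le h.dist hA (x := α) (R := 5 * A₀ ^ 3 * δ ^ k) (s := δ ^ k) ?_
    ((R.pts_separated k).mono (by rintro _ ⟨β, -, rfl⟩; exact β.2)) ?_
  · rintro _ ⟨β, ⟨-, γ, rfl, η, rfl, hγη⟩, rfl⟩
    change d _ _ < _
    have h1 := R.dist_parent k γ
    rw [h.dist.symm] at h1
    refine (h.dist.triangle_lt hA h1 (h.dist.triangle_lt hA hγη (R.dist_parent k η))).trans_le ?_
    have h2 : A₀ * (2 * A₀ * δ ^ k + A₀ * ((2 * A₀)⁻¹ * δ ^ k + 2 * A₀ * δ ^ k)) =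
        (2 * A₀ ^ 2 + A₀ / 2 + 2 * A₀ ^ 3) * δ ^ k := by
      have := h.A_pos
      field_simp
      ring
    rw [h2]
    refine mul_le_mul_of_nonneg_right ?_ hpos.le
    have h3 : A₀ ^ 2 ≤ A₀ ^ 3 := pow_le_pow_right₀ hA (by norm_num)
    have h4 : A₀ ≤ A₀ ^ 3 := le_self_pow₀ hA (by norm_num)
    linarith
  · have h3 : 10 * A₀ ^ 4 * (3 / 4) ^ j ≤ 1 := hj.trans (by linarith [h.le_thousandth])
    calc 2 * A₀ * (5 * A₀ ^ 3 * δ ^ k) * (3 / 4) ^ j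
        = δ ^ k * (10 * A₀ ^ 4 * (3 / 4) ^ j) := by ring
      _ ≤ δ ^ k * 1 := mul_le_mul_of_nonneg_left h3 hpos.le
      _ = δ ^ k := mul_one _

end ReferenceSystem

namespace DyadicSystem

variable (D : DyadicSystem d A₀ δ)

/-- The probability that the coordinates in a finite set all avoid prescribed values. -/
theorem prob_avoid (a : D.Param) (s : Finset ℤ) :
    D.prob {ω | ∀ m ∈ s, ω m ≠ a m} =
      (1 - (((D.L + 1) * D.M : ℕ) : ENNReal)⁻¹) ^ s.card := by
  have hset : {ω : D.Param | ∀ m ∈ s, ω m ≠ a m} = Set.pi s fun m => {a m}ᶜ := rfl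
  unfold prob
  rw [hset, Measure.infinitePi_pi _ (fun m _ => (measurableSet_singleton _).compl),
    Finset.prod_congr rfl (g := fun _ => 1 - (((D.L + 1) * D.M : ℕ) : ENNReal)⁻¹),
    Finset.prod_const]
  intro m _
  rw [prob_compl_eq_one_sub (measurableSet_singleton _),
    PMF.toMeasure_apply_singleton _ _ (measurableSet_singleton _), PMF.uniformOfFintype_apply]
  simp

theorem prob_avoid_le (h : IsAdmissible d A₀ δ) {N : ℕ} (hN : GeomDoubling d N) {j : ℕ}
    (hj : 10 * A₀ ^ 4 * (3 / 4) ^ j ≤ δ) (a : D.Param) (s : Finset ℤ) :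
    D.prob {ω | ∀ m ∈ s, ω m ≠ a m} ≤
      ENNReal.ofReal ((1 - 1 / ((N ^ j : ℕ) + 2 : ℝ) ^ 2) ^ s.card) := by
  obtain ⟨k, α, hα⟩ := D.isGreatest_L.1
  obtain ⟨k', α', hα'⟩ := D.isGreatest_M.1
  have hL : D.L ≤ N ^ j := by
    exact_mod_cast hα.trans_le (D.encard_neighbours_le h hN hj k α)
  have hM : D.M ≤ N ^ j := by
    exact_mod_cast hα'.trans_le (D.encard_children_le h hN hj k' α')
  have hM0 : 0 < D.M := Nat.pos_of_ne_zero D.M_ne_zero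
  generalize N ^ j = K at *
  rw [D.prob_avoid]
  -- The bound is independent of the system. The summand 2 keeps the resulting ratio strictly
  -- between 0 and 1 even for `K = 0`.
  have hLM : (D.L + 1) * D.M ≤ (K + 2) ^ 2 := by
    rw [sq]
    exact Nat.mul_le_mul (by omega) (by omega)
  have hpos : 0 < (D.L + 1) * D.M := Nat.mul_pos (Nat.succ_pos _) hM0
  generalize (D.L + 1) * D.M = T at *
  have hK : (0 : ℝ) < 1 / ((K : ℝ) + 2) ^ 2 := by positivity
  have hK1 : 1 / ((K : ℝ) + 2) ^ 2 ≤ 1 := by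
    rw [div_le_one (by positivity)]
    exact one_le_pow₀ (by linarith [Nat.cast_nonneg (α := ℝ) K])
  rw [ENNReal.ofReal_pow (by linarith), ENNReal.ofReal_sub _ hK.le, ENNReal.ofReal_one]
  refine pow_le_pow_left' (tsub_le_tsub_left ?_ _) _
  rw [one_div, ENNReal.ofReal_inv_of_pos (by positivity), ENNReal.inv_le_inv]
  rw [← ENNReal.ofReal_natCast]
  exact ENNReal.ofReal_le_ofReal (by exact_mod_cast hLM)

/-- If a point lies in a thin boundary layer, then the random choices of all intermediate
generations avoid the value that would put a new dyadic point next to it. -/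
theorem exists_boundaryLayer_subset (h : IsAdmissible d A₀ δ) {N : ℕ} (hN : GeomDoubling d N)
    (x : X) : ∃ a : D.Param, ∀ (k : ℤ) (n : ℕ) (ε : ℝ), ε ≤ 1 / 12 * (A₀ ^ 6)⁻¹ * δ ^ n →
      {ω | x ∈ ⋃ α : D.pts k, D.boundaryLayer ε ω k α} ⊆
        {ω | ∀ m ∈ Finset.Icc k (k + n), ω m ≠ a m} := by
  have hA := h.A_pos
  choose β hβ hxβ using fun m : ℤ => D.exists_pt_near h (m + 1) x
  refine ⟨fun m => (D.label₁ m (D.parent m ⟨β m, hβ m⟩), D.label₂ (m + 1) ⟨β m, hβ m⟩),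
    fun k n ε hε ω hω m hm hωm => ?_⟩
  obtain ⟨α, hα, hdist⟩ := Set.mem_iUnion.1 hω
  obtain ⟨w, hw⟩ := iInf_lt_iff.1 hdist
  obtain ⟨hwα, hxw⟩ := iInf_lt_iff.1 hw
  have hxw' : d x w < ε * δ ^ k := (ENNReal.ofReal_lt_ofReal_iff'.1 hxw).1
  rw [Finset.mem_Icc] at hm
  have hz := D.newPt_of_label ω m ⟨β m, hβ m⟩ hωm
  set γ := D.parent m ⟨β m, hβ m⟩
  have hpos := h.zpow_pos m
  have hzx : d (D.newPt ω m γ) x < 1 / 12 * (A₀ ^ 6)⁻¹ * δ ^ m := by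
    rw [hz, h.dist.symm]
    refine (hxβ m).trans_le ?_
    rw [h.zpow_succ]
    have h1 := h.pow_mul_le (j := 7) (by norm_num)
    have h2 : 2 * A₀ * (δ ^ m * δ) = (A₀ ^ 6)⁻¹ * δ ^ m * (2 * (A₀ ^ 7 * δ)) := by
      field_simp
    have h3 : 1 / 12 * (A₀ ^ 6)⁻¹ * δ ^ m = (A₀ ^ 6)⁻¹ * δ ^ m * (1 / 12) := by ring
    rw [h2, h3]
    exact mul_le_mul_of_nonneg_left (by linarith) (by positivity)
  -- Here `m ≤ k + n` enters. The constant 1/12 is half of 1/6, so that `x` and `w` both fall into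
  -- the inner ball about the new point.
  have hxw'' : d x w < 1 / 12 * (A₀ ^ 6)⁻¹ * δ ^ m := by
    refine hxw'.trans_le ((mul_le_mul_of_nonneg_right hε (h.zpow_pos k).le).trans ?_)
    rw [mul_assoc]
    refine mul_le_mul_of_nonneg_left ?_ (by positivity)
    rw [← zpow_natCast, ← zpow_add₀ h.pos.ne']
    exact h.zpow_anti (by linarith)
  have hle : A₀ * (1 / 12 * (A₀ ^ 6)⁻¹ * δ ^ m + 1 / 12 * (A₀ ^ 6)⁻¹ * δ ^ m) =
      1 / 6 * (A₀ ^ 5)⁻¹ * δ ^ m := by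
    field_simp
    norm_num
  have hwγ : w ∈ D.openCube ω m γ :=
    D.ball_subset_openCube h hN ω m γ ((h.dist.triangle_lt h.one_le hzx hxw'').trans_eq hle)
  have hxγ : x ∈ D.openCube ω m γ := by
    refine D.ball_subset_openCube h hN ω m γ
      ((h.dist.triangle_lt h.one_le hzx (z := x) (y := x) ?_).trans_eq hle)
    rw [h.dist.self]
    positivity
  -- Here `k ≤ m` enters: the cube of `α` contains a cube of generation `m` through `x`, which must
  -- be that of `γ`. Then `w` is interior to the cube of `α`, a contradiction.
  obtain ⟨l, hl, θ, hθα, hxθ⟩ := D.exists_descendant h hN hα (m - k).toNat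
  obtain rfl : l = m := by omega
  obtain rfl := D.eq_of_mem_closedCube_of_mem_openCube h hN hxθ hxγ
  exact hwα (D.openCube_mono hθα hwγ)

theorem boundary_subset_boundaryLayer (h : IsAdmissible d A₀ δ) {ε : ℝ} (hε : 0 < ε) (ω : D.Param)
    (k : ℤ) (α : D.pts k) : D.boundary ω k α ⊆ D.boundaryLayer ε ω k α := by
  rintro x ⟨hx, hx'⟩
  refine ⟨hx, iInf_lt_iff.2 ⟨x, iInf_lt_iff.2 ⟨hx', ?_⟩⟩⟩
  rw [h.dist.self, ENNReal.ofReal_zero, ENNReal.ofReal_pos]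
  exact mul_pos hε (h.zpow_pos k)

theorem prob_boundary_eq_zero (h : IsAdmissible d A₀ δ) {η C : ℝ} (hη : 0 < η) {x : X}
    (hlayer : ∀ (k : ℤ) (ε : ℝ), 0 < ε → D.prob {ω | x ∈ ⋃ α : D.pts k, D.boundaryLayer ε ω k α} ≤
      ENNReal.ofReal (C * ε ^ η)) :
    D.prob {ω | x ∈ ⋃ (k : ℤ) (α : D.pts k), D.boundary ω k α} = 0 := by
  have hset : {ω : D.Param | x ∈ ⋃ (k : ℤ) (α : D.pts k), D.boundary ω k α} =
      ⋃ k : ℤ, {ω : D.Param | x ∈ ⋃ α : D.pts k, D.boundary ω k α} := by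
    ext ω
    simp
  -- Only the union over the countably many generations is split; the union over `α` stays inside
  -- the event.
  rw [hset, measure_iUnion_null_iff]
  intro k
  have hlim : Filter.Tendsto (fun ε : ℝ => ENNReal.ofReal (C * ε ^ η)) (nhdsWithin 0 (Set.Ioi 0))
      (nhds 0) := by
    have h1 : Filter.Tendsto (fun ε : ℝ => C * ε ^ η) (nhds 0) (nhds (C * 0 ^ η)) :=
      (Real.continuousAt_rpow_const 0 η (Or.inr hη.le)).tendsto.const_mul C
    rw [Real.zero_rpow hη.ne', mul_zero] at h1
    have h2 := ENNReal.tendsto_ofReal h1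
    rw [ENNReal.ofReal_zero] at h2
    exact h2.mono_left nhdsWithin_le_nhds
  refine le_antisymm (ge_of_tendsto hlim ?_) zero_le
  filter_upwards [self_mem_nhdsWithin] with ε hε
  refine (measure_mono fun ω hω => ?_).trans (hlayer k ε hε)
  obtain ⟨α, hα⟩ := Set.mem_iUnion.1 hω
  exact Set.mem_iUnion.2 ⟨α, D.boundary_subset_boundaryLayer h hε ω k α hα⟩

instance isProbabilityMeasure_prob : IsProbabilityMeasure D.prob := by
  unfold prob
  infer_instance

theorem prob_boundaryLayer_le (h : IsAdmissible d A₀ δ) {N : ℕ} (hN : GeomDoubling d N) {j : ℕ}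
    (hj : 10 * A₀ ^ 4 * (3 / 4) ^ j ≤ δ) {b ε : ℝ} (x : X) (k : ℤ)
    (hb : 1 ≤ b ∨ ∃ n : ℕ, ε ≤ 1 / 12 * (A₀ ^ 6)⁻¹ * δ ^ n ∧
      (1 - 1 / ((N ^ j : ℕ) + 2 : ℝ) ^ 2) ^ (n + 1) ≤ b) :
    D.prob {ω | x ∈ ⋃ α : D.pts k, D.boundaryLayer ε ω k α} ≤ ENNReal.ofReal b := by
  rcases hb with hb | ⟨n, hn, hb⟩
  · exact prob_le_one.trans (ENNReal.one_le_ofReal.2 hb)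
  · obtain ⟨a, ha⟩ := D.exists_boundaryLayer_subset h hN x
    refine (measure_mono (ha k n ε hn)).trans ((D.prob_avoid_le h hN hj a _).trans
      (ENNReal.ofReal_le_ofReal ?_))
    rw [Int.card_Icc, show (k + n + 1 - k).toNat = n + 1 by omega]
    exact hb

end DyadicSystem

-- Existence of reference points, orders and labels.

/-- Greedy colouring: a graph with degrees at most `L` can be coloured with `L + 1` colours. -/
theorem exists_coloring {V : Type*} (r : V → V → Prop) (hr : ∀ v w, r v w → r w v)
    (hne : ∀ v w, r v w → v ≠ w) (L : ℕ) (hL : ∀ v, {w | r v w}.encard ≤ L) :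
    ∃ f : V → Fin (L + 1), ∀ v w, r v w → f v ≠ f w := by
  classical
  have hstep : ∀ (v : V) (g : ∀ w, WellOrderingRel w v → Fin (L + 1)),
      ∃ c, ∀ w (hw : WellOrderingRel w v), r v w → g w hw ≠ c := by
    intro v g
    by_contra! hcon
    let g' : V → Fin (L + 1) := fun w => if hw : WellOrderingRel w v then g w hw else 0
    -- If no colour were free, the at most `L` neighbours would carry all `L + 1` colours. The
    -- default value of `g'` plays no role.
    have huniv : (Set.univ : Set (Fin (L + 1))) ⊆ g' '' {w | r v w} := by
      intro c _
      obtain ⟨w, hw, hvw, hc⟩ := hcon c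
      exact ⟨w, hvw, by simp only [g', dif_pos hw, hc]⟩
    have h1 := (Set.encard_le_encard huniv).trans ((Set.encard_image_le _ _).trans (hL v))
    rw [Set.encard_univ, ENat.card_eq_coe_fintype_card, Fintype.card_fin] at h1
    norm_cast at h1
    omega
  choose c hc using hstep
  have hwf : WellFounded (WellOrderingRel (α := V)) := IsWellFounded.wf
  have hlt : ∀ v w, WellOrderingRel w v → r v w → hwf.fix c w ≠ hwf.fix c v := by
    intro v w hwv hvw
    rw [hwf.fix_eq c v]
    exact hc v (fun y _ => hwf.fix c y) w hwv hvw
  refine ⟨hwf.fix c, fun v w hvw => ?_⟩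
  rcases trichotomous_of WellOrderingRel v w with hlt' | heq | hlt'
  · exact hlt w v hlt' (hr v w hvw)
  · exact absurd heq (hne v w hvw)
  · exact (hlt v w hlt' hvw).symm

theorem exists_isGreatest_of_le {S : Set ℕ∞} (hS : S.Nonempty) {K : ℕ} (hK : ∀ n ∈ S, n ≤ K) :
    ∃ L : ℕ, IsGreatest S L := by
  have hfin : S.Finite := by
    refine ((Set.finite_Iic K).image ((↑) : ℕ → ℕ∞)).subset fun n hn => ?_
    lift n to ℕ using ne_top_of_le_ne_top (ENat.natCast_ne_top K) (hK n hn)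
    exact ⟨n, by exact_mod_cast hK _ hn, rfl⟩
  obtain ⟨m, hm, hmax⟩ := Set.exists_max_image S id hfin hS
  lift m to ℕ using ne_top_of_le_ne_top (ENat.natCast_ne_top K) (hK m hm)
  exact ⟨m, hm, hmax⟩

theorem exists_isMaxSeparated_superset {r : ℝ} {Y S : Set X} (hSY : S ⊆ Y)
    (hS : S.Pairwise (fun x y => r ≤ d x y)) : ∃ T, S ⊆ T ∧ IsMaxSeparated d r Y T := by
  refine zorn_subset_nonempty {T : Set X | T ⊆ Y ∧ T.Pairwise (fun x y => r ≤ d x y)} ?_ S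
    ⟨hSY, hS⟩
  intro c hc hchain _
  refine ⟨⋃₀ c, ⟨Set.sUnion_subset fun T hT => (hc hT).1, ?_⟩,
    fun T hT => Set.subset_sUnion_of_mem hT⟩
  rw [Set.pairwise_sUnion hchain.directedOn]
  exact fun T hT => (hc hT).2

theorem exists_isPointSystem (h : IsAdmissible d A₀ δ) : ∃ pts, IsPointSystem d δ pts := by
  -- Separation is a premise inside the existential, so that the chosen extension is a total
  -- function usable in the recursion.
  have hext : ∀ (r : ℝ) (S : Set X), ∃ T, S.Pairwise (fun x y => r ≤ d x y) →
      S ⊆ T ∧ IsMaxSeparated d r Set.univ T := by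
    intro r S
    by_cases hS : S.Pairwise (fun x y => r ≤ d x y)
    · obtain ⟨T, hT⟩ := exists_isMaxSeparated_superset (Set.subset_univ S) hS
      exact ⟨T, fun _ => hT⟩
    · exact ⟨S, fun hS' => absurd hS' hS⟩
  have hsub : ∀ (r : ℝ) (Y : Set X), ∃ T, IsMaxSeparated d r Y T := fun r Y =>
    (exists_isMaxSeparated_superset (Set.empty_subset Y) (Set.pairwise_empty _)).imp
      fun _ hT => hT.2
  choose ext hext using hext
  choose sub hsub using hsub
  let f : ℕ → Set X := fun n => Nat.rec (sub 1 Set.univ) (fun n S => ext (δ ^ ((n : ℤ) + 1)) S) n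
  let g : ℕ → Set X := fun n => Nat.rec (f 0) (fun n S => sub (δ ^ (-((n : ℤ) + 1))) S) n
  have hf0 : IsMaxSeparated d 1 Set.univ (f 0) := hsub 1 Set.univ
  have hstep : ∀ n : ℕ, (f n).Pairwise (fun x y => δ ^ (n : ℤ) ≤ d x y) →
      f n ⊆ f (n + 1) ∧ IsMaxSeparated d (δ ^ ((n : ℤ) + 1)) Set.univ (f (n + 1)) := by
    intro n hn
    exact hext _ _ (hn.mono' fun x y hxy => (h.zpow_anti (by omega)).trans hxy)
  have hsep : ∀ n : ℕ, (f n).Pairwise (fun x y => δ ^ (n : ℤ) ≤ d x y) := by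
    intro n
    induction n with
    | zero => simpa using hf0.1.2
    | succ n ih => exact_mod_cast (hstep n ih).2.1.2
  refine ⟨fun k => match k with
    | Int.ofNat n => f n
    | Int.negSucc n => g (n + 1), hf0, fun n => hstep n (hsep n), fun n => ?_⟩
  have hg : IsMaxSeparated d (δ ^ (-((n : ℤ) + 1))) (g n) (g (n + 1)) := hsub _ _
  have e1 : -((n : ℤ) + 1) = Int.negSucc n := by omega
  cases n with
  | zero => exact hg
  | succ n => exact hg

theorem nonempty_referenceSystem (h : IsAdmissible d A₀ δ) :
    Nonempty (ReferenceSystem d A₀ δ) := by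
  obtain ⟨pts, hpts⟩ := exists_isPointSystem h
  have hpar : ∀ (k : ℤ) (β : pts (k + 1)), ∃ α : pts k,
      (∀ α' : pts k, d β α' < 1 / (2 * A₀) * δ ^ k → α = α') ∧ d β α < 2 * A₀ * δ ^ k := by
    intro k β
    have hA := h.one_le
    have hpos := h.zpow_pos k
    have hle : 1 / (2 * A₀) * δ ^ k ≤ 2 * A₀ * δ ^ k := by
      refine mul_le_mul_of_nonneg_right ?_ hpos.le
      rw [div_le_iff₀ (by positivity)]
      nlinarith
    -- At most one point is this near, by separation, so it can be taken as the parent.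
    by_cases hc : ∃ α : pts k, d β α < 1 / (2 * A₀) * δ ^ k
    · obtain ⟨α, hα⟩ := hc
      refine ⟨α, fun α' hα' => ?_, hα.trans_le hle⟩
      by_contra hne
      have h1 := hpts.separated k α.2 α'.2 (fun he => hne (Subtype.ext he))
      rw [h.dist.symm] at hα
      have h2 := h.dist.triangle_lt hA hα hα'
      have h3 : A₀ * (1 / (2 * A₀) * δ ^ k + 1 / (2 * A₀) * δ ^ k) = δ ^ k := by
        field_simp
        norm_num
      linarith
    · obtain ⟨α, hα, hβα⟩ := hpts.exists_near_succ h k β.2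
      exact ⟨⟨α, hα⟩, fun α' hα' => absurd ⟨α', hα'⟩ hc,
        hβα.trans_le (le_mul_of_one_le_left hpos.le (by linarith))⟩
  choose parent hp1 hp2 using hpar
  exact ⟨⟨pts, hpts.zero, hpts.pos, hpts.neg, parent, fun k β α hβα => hp1 k β α hβα, hp2⟩⟩

theorem nonempty_dyadicSystem [Nonempty X] (h : IsAdmissible d A₀ δ) {N : ℕ}
    (hN : GeomDoubling d N) : Nonempty (DyadicSystem d A₀ δ) := by
  classical
  obtain ⟨R⟩ := nonempty_referenceSystem h
  obtain ⟨j, hj⟩ := exists_pow_lt_of_lt_one (div_pos h.pos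
    (by have := h.A_pos; positivity : 0 < 10 * A₀ ^ 4)) (by norm_num : (3 / 4 : ℝ) < 1)
  rw [lt_div_iff₀' (by have := h.A_pos; positivity)] at hj
  obtain ⟨α₀, hα₀, -⟩ := R.exists_pt_near h 0 (Classical.arbitrary X)
  obtain ⟨L, hL⟩ := exists_isGreatest_of_le
    (S := {n : ℕ∞ | ∃ (k : ℤ) (α : R.pts k), n = {β | R.IsNeighbour k α β}.encard})
    ⟨_, 0, ⟨α₀, hα₀⟩, rfl⟩ (K := N ^ j) (by
      rintro _ ⟨k, α, rfl⟩
      exact R.encard_neighbours_le h hN hj.le k α)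
  obtain ⟨M, hM⟩ := exists_isGreatest_of_le
    (S := {n : ℕ∞ | ∃ (k : ℤ) (α : R.pts k), n = (R.children k α).encard})
    ⟨_, 0, ⟨α₀, hα₀⟩, rfl⟩ (K := N ^ j) (by
      rintro _ ⟨k, α, rfl⟩
      exact R.encard_children_le h hN hj.le k α)
  have hM0 : M ≠ 0 := by
    rintro rfl
    have h1 : (R.children 0 ⟨α₀, hα₀⟩).encard ≤ 0 := hM.2 ⟨0, ⟨α₀, hα₀⟩, rfl⟩
    have h2 := Set.encard_eq_zero.1 (le_antisymm h1 bot_le)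
    have h3 : ⟨α₀, R.pts_mono 0 hα₀⟩ ∈ R.children 0 ⟨α₀, hα₀⟩ := R.parent_self h 0 ⟨α₀, hα₀⟩
    rw [h2] at h3
    exact h3
  have : NeZero M := ⟨hM0⟩
  have hlab1 : ∀ k : ℤ, ∃ f : R.pts k → Fin (L + 1), ∀ α β, R.IsNeighbour k α β → f α ≠ f β := by
    intro k
    refine exists_coloring _ ?_ (fun α β hαβ => hαβ.1) L fun α => hL.2 ⟨k, α, rfl⟩
    rintro α β ⟨hne, γ, hγ, η, hη, hlt⟩
    exact ⟨hne.symm, η, hη, γ, hγ, by rwa [h.dist.symm]⟩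
  have hlab2 : ∀ (k : ℤ) (α : R.pts k), ∃ f : R.pts (k + 1) → Fin M,
      Set.InjOn f (R.children k α) := by
    intro k α
    have hle := hM.2 ⟨k, α, rfl⟩
    obtain ⟨f, -, hf⟩ := (Set.finite_of_encard_le_coe hle).exists_injOn_of_encard_le
      (t := (Set.univ : Set (Fin M))) (by
        rwa [Set.encard_univ, ENat.card_eq_coe_fintype_card, Fintype.card_fin])
    exact ⟨f, hf⟩
  choose f₁ hf₁ using hlab1
  choose f₂ hf₂ using hlab2
  -- The labels are defined on all of `X`, with junk value 0, because `k + 1 - 1` is not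
  -- definitionally `k` and labels on subtypes would need transport.
  let g : ℤ → X → Fin M := fun k x =>
    if hx : x ∈ R.pts (k + 1) then f₂ k (R.parent k ⟨x, hx⟩) ⟨x, hx⟩ else 0
  have hg : ∀ (k : ℤ) (β : R.pts (k + 1)), g (k + 1 - 1) β = f₂ k (R.parent k β) β := by
    intro k β
    rw [add_sub_cancel_right]
    exact dif_pos β.2
  refine ⟨{ R with
    L := L
    M := M
    isGreatest_L := hL
    isGreatest_M := hM
    label₁ := f₁
    label₂ := fun k β => g (k - 1) β
    label₁_ne := hf₁
    label₂_ne := fun k β γ hne hpar heq => hne ?_ }⟩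
  change R.parent k β = R.parent k γ at hpar
  change g (k + 1 - 1) β = g (k + 1 - 1) γ at heq
  rw [hg, hg, hpar] at heq
  exact hf₂ k (R.parent k γ) hpar rfl heq

end QuasiDyadic

-- The main theorem.

theorem mainTheorem5 (A₀ : ℝ) (hA₀ : 1 ≤ A₀) (N : ℕ)
    (δ : ℝ) (hδ : 0 < δ) (hδ' : δ ≤ 1 / 1000 * (A₀ ^ 10)⁻¹) :
    ∃ η C : ℝ, 0 < η ∧ η ≤ 1 ∧ 0 < C ∧
      ∀ (X : Type*) [Nonempty X] (d : X → X → ℝ),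
        QuasiDyadic.IsQuasiDist A₀ d → QuasiDyadic.GeomDoubling d N →
        Nonempty (QuasiDyadic.DyadicSystem d A₀ δ) ∧
        ∀ D : QuasiDyadic.DyadicSystem d A₀ δ,
          (∀ (ω : D.Param) (k : ℤ),
            (⋃ α : D.pts k, D.closedCube ω k α) = Set.univ ∧
            (∀ α : D.pts k, D.closedCube ω k α =
              ⋃ β : {β : D.pts (k + 1) // D.NewLE ω ⟨k + 1, β⟩ ⟨k, α⟩},
                D.closedCube ω (k + 1) β.1) ∧
            (∀ α β : D.pts k, α ≠ β → D.closedCube ω k α ∩ D.openCube ω k β = ∅) ∧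
            (∀ α : D.pts k,
              QuasiDyadic.ball d (D.newPt ω k α) (1 / 6 * (A₀ ^ 5)⁻¹ * δ ^ k)
                  ⊆ D.openCube ω k α ∧
              D.openCube ω k α ⊆ D.closedCube ω k α ∧
              D.closedCube ω k α
                  ⊆ QuasiDyadic.ball d (D.newPt ω k α) (6 * A₀ ^ 4 * δ ^ k))) ∧
          (∀ (x : X) (k : ℤ) (ε : ℝ), 0 < ε →
            D.prob {ω | x ∈ ⋃ α : D.pts k, D.boundaryLayer ε ω k α}
              ≤ ENNReal.ofReal (C * ε ^ η)) ∧
          (∀ x : X,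
            D.prob {ω | x ∈ ⋃ (k : ℤ) (α : D.pts k), D.boundary ω k α} = 0) := by
  have hA : 0 < A₀ := by linarith
  have hδ1 : δ < 1 := by
    have : (A₀ ^ 10)⁻¹ ≤ 1 := inv_le_one_of_one_le₀ (one_le_pow₀ hA₀)
    linarith
  -- Everything that determines `η` and `C` is fixed before the space appears.
  obtain ⟨j, hj⟩ := exists_pow_lt_of_lt_one (div_pos hδ
    (by positivity : 0 < 10 * A₀ ^ 4)) (by norm_num : (3 / 4 : ℝ) < 1)
  rw [lt_div_iff₀' (by positivity)] at hj
  have hq : 1 / ((N ^ j : ℕ) + 2 : ℝ) ^ 2 < 1 := by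
    rw [div_lt_one (by positivity)]
    exact one_lt_pow₀ (by linarith [Nat.cast_nonneg (α := ℝ) (N ^ j)]) (by norm_num)
  have hq' : 0 < 1 / ((N ^ j : ℕ) + 2 : ℝ) ^ 2 := by positivity
  obtain ⟨η, C, hη, hη1, hC, hbound⟩ := QuasiDyadic.exists_rpow_bound (sub_pos.2 hq)
    (by linarith) hδ hδ1 (by positivity : 0 < 1 / 12 * (A₀ ^ 6)⁻¹)
  refine ⟨η, C, hη, hη1, hC, fun X _ d hd hN => ?_⟩
  have h : QuasiDyadic.IsAdmissible d A₀ δ := ⟨hd, hA₀, hδ, hδ'⟩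
  refine ⟨QuasiDyadic.nonempty_dyadicSystem h hN, fun D => ?_⟩
  have hlayer : ∀ (x : X) (k : ℤ) (ε : ℝ), 0 < ε →
      D.prob {ω | x ∈ ⋃ α : D.pts k, D.boundaryLayer ε ω k α} ≤ ENNReal.ofReal (C * ε ^ η) :=
    fun x k ε hε => D.prob_boundaryLayer_le h hN hj.le x k (hbound ε hε)
  refine ⟨fun ω k => ⟨?_, fun α => ?_, fun α β hne => ?_, fun α => ⟨?_, ?_, ?_⟩⟩, hlayer,
    fun x => D.prob_boundary_eq_zero h hη (hlayer x)⟩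
  · exact Set.eq_univ_of_forall fun x => Set.mem_iUnion.2 (D.exists_mem_closedCube h hN ω k x)
  · ext x
    rw [D.mem_closedCube_iff h hN, Set.mem_iUnion]
    exact ⟨fun ⟨β, hβ, hx⟩ => ⟨⟨β, hβ.newLE⟩, hx⟩,
      fun ⟨β, hx⟩ => ⟨β.1, D.newLE_succ_iff.1 β.2, hx⟩⟩
  · exact Set.eq_empty_of_forall_notMem fun x hx =>
      hne (D.eq_of_mem_closedCube_of_mem_openCube h hN hx.1 hx.2)
  · exact D.ball_subset_openCube h hN ω k α
  · exact D.openCube_subset ω k α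
  · exact fun x hx => D.dist_lt_of_mem_closedCube h hN hx
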